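/- Let $T>0$, $B\in\mathbb R^{n\times m}$, $C\in\mathbb R^{r\times n}$, $x_0\in\mathbb R^n$, and let $(A_k,\Gamma_k,R_k,Q_k)$, $k=1,\dots,N$ ($N\ge 1$), be finitely many tuples of real matrices with $A_k\in\mathbb R^{n\times n}$ arbitrary and $\Gamma_k\in\mathbb R^{n\times n}$, $R_k\in\mathbb R^{m\times m}$, $Q_k\in\mathbb R^{r\times r}$ symmetric positive definite. Let $y\in L^2(0,T;\mathbb R^r)$ and write $\|x\|_M^2=x^\top Mx$. For $t\in(0,T]$ and $\xi\in\mathbb R^n$ let $$\mathcal V_k(t,\xi)=\inf\Big\{\|x(0)-x_0\|_{\Gamma_k^{-1}}^2+\int_0^t\big(\|v(s)\|_{R_k^{-1}}^2+\|y(s)-Cx(s)\|_{Q_k^{-1}}^2\big)\,ds\Big\},$$ the infimum being taken over all $x\in H^1(0,t;\mathbb R^n)$ and $v\in L^2(0,t;\mathbb R^m)$ with $\dot x=A_kx+Bv$ on $(0,t)$ and $x(t)=\xi$; let $\mathcal V_k(0,\xi)=\|\xi-x_0\|_{\Gamma_k^{-1}}^2$. For $t\in[0,T]$ and $\theta\in(0,\infty)$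 let $\widehat x_0(t)$, $\widehat x_\infty(t)$ and $\widehat x_\theta(t)$ denote the unique minimizers over $x\in\mathbb R^n$ of, respectively, $$\frac1N\sum_{k=1}^N\mathcal V_k(t,x),\qquad \max_{1\le k\le N}\mathcal V_k(t,x),\qquad \frac1\theta\ln\Big(\frac1N\sum_{k=1}^N e^{\theta\mathcal V_k(t,x)}\Big).$$ Then: 1. $\widehat x_0\in W^{1,1}(0,T;\mathbb R^n)$, $\widehat x_\theta\in W^{1,1}(0,T;\mathbb R^n)$ for every $\theta\in(0,\infty)$, and $\|\widehat x_\theta-\widehat x_0\|_{W^{1,1}(0,T;\mathbb R^n)}\to 0$ as $\theta\to 0^+$. 2. For every $1\le p<\infty$, $\widehat x_\infty\in L^p(0,T;\mathbb R^n)$, $\widehat x_\theta\in L^p(0,T;\mathbb R^n)$ for every $\theta\in(0,\infty)$, and $\|\widehat x_\theta-\widehat x_\infty\|_{L^p(0,T;\mathbb R^n)}\to 0$ as $\theta\to\infty$. -/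

import Mathlib

open MeasureTheory Set Filter Topology
open scoped ContDiff ENNReal

noncomputable section

namespace RiskAverseKalman

/-- Euclidean space `ℝᵈ`. -/
abbrev E (d : ℕ) : Type := EuclideanSpace ℝ (Fin d)

/-- The weighted square `‖x‖_M² = xᵀ M x`. -/
def sqNorm {d : ℕ} (M : Matrix (Fin d) (Fin d) ℝ) (x : E d) : ℝ :=
  inner ℝ x (M.toEuclideanLin x)

/-- `g` is a weak derivative of `u` on the open interval `(a, b)`. -/
def HasWeakDeriv {d : ℕ} (a b : ℝ) (u g : ℝ → E d) : Prop :=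
  LocallyIntegrableOn u (Ioo a b) ∧ LocallyIntegrableOn g (Ioo a b) ∧
    ∀ φ : ℝ → ℝ, ContDiff ℝ ∞ φ → HasCompactSupport φ → tsupport φ ⊆ Ioo a b →
      ∫ s in Ioo a b, deriv φ s • u s = - ∫ s in Ioo a b, φ s • g s

/-- `u ∈ L^p(a, b; ℝᵈ)`. -/
def MemLpI {d : ℕ} (p : ℝ≥0∞) (a b : ℝ) (u : ℝ → E d) : Prop :=
  MemLp u p (volume.restrict (Ioo a b))

/-- The norm of `L^p(a, b; ℝᵈ)`, with values in `[0, ∞]`. -/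
def normLp {d : ℕ} (p : ℝ≥0∞) (a b : ℝ) (u : ℝ → E d) : ℝ≥0∞ :=
  eLpNorm u p (volume.restrict (Ioo a b))

/-- `u ∈ W^{1,p}(a, b; ℝᵈ)`; for `p = 2` this is `H¹(a, b; ℝᵈ)`. -/
def MemW1 {d : ℕ} (p : ℝ≥0∞) (a b : ℝ) (u : ℝ → E d) : Prop :=
  MemLpI p a b u ∧ ∃ g : ℝ → E d, MemLpI p a b g ∧ HasWeakDeriv a b u g

/-- The weak derivative of `u` on `(a, b)`. It is determined up to a null set of `(a, b)`
whenever it exists (and is meaningless otherwise). -/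
def weakDeriv {d : ℕ} (a b : ℝ) (u : ℝ → E d) : ℝ → E d :=
  Classical.epsilon fun g => HasWeakDeriv a b u g

/-- The norm `‖u‖_{L¹} + ‖u'‖_{L¹}` of `u ∈ W^{1,1}(a, b; ℝᵈ)`. -/
def normW11 {d : ℕ} (a b : ℝ) (u : ℝ → E d) : ℝ≥0∞ :=
  normLp 1 a b u + normLp 1 a b (weakDeriv a b u)

/-- The data of an uncertain linear system: a family of system matrices `A k` and weighting
matrices `Γ k`, `R k`, `Q k` indexed by the finite parameter set, and the known matrices `B`, `C`
and initial guess `x₀`. -/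
structure UncertainSystem (n m r : ℕ) (ι : Type*) where
  A : ι → Matrix (Fin n) (Fin n) ℝ
  Γ : ι → Matrix (Fin n) (Fin n) ℝ
  R : ι → Matrix (Fin m) (Fin m) ℝ
  Q : ι → Matrix (Fin r) (Fin r) ℝ
  B : Matrix (Fin n) (Fin m) ℝ
  C : Matrix (Fin r) (Fin n) ℝ
  x₀ : E n

namespace UncertainSystem

variable {n m r : ℕ} {ι : Type*}

/-- The pair `(x, v) ∈ H¹(0, t; ℝⁿ) × L²(0, t; ℝᵐ)` satisfies `x' = A_k x + B v` on `(0, t)` and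
`x(t) = ξ`. As usual `x ∈ H¹` is identified with its continuous representative on `[0, t]`. -/
def Admissible (S : UncertainSystem n m r ι) (k : ι) (t : ℝ) (ξ : E n)
    (x : ℝ → E n) (v : ℝ → E m) : Prop :=
  ContinuousOn x (Icc 0 t) ∧ MemW1 2 0 t x ∧ MemLpI 2 0 t v ∧
    HasWeakDeriv 0 t x (fun s => (S.A k).toEuclideanLin (x s) + S.B.toEuclideanLin (v s)) ∧
    x t = ξ

/-- The energy `‖x(0) - x₀‖²_{Γ⁻¹} + ∫₀ᵗ ‖v‖²_{R⁻¹} + ‖y - C x‖²_{Q⁻¹} ds` for the parameter `k`. -/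
def cost (S : UncertainSystem n m r ι) (y : ℝ → E r) (k : ι) (t : ℝ)
    (x : ℝ → E n) (v : ℝ → E m) : ℝ :=
  sqNorm (S.Γ k)⁻¹ (x 0 - S.x₀) +
    ∫ s in Ioo 0 t, (sqNorm (S.R k)⁻¹ (v s) + sqNorm (S.Q k)⁻¹ (y s - S.C.toEuclideanLin (x s)))

open Classical in
/-- The value function `𝒱_k(t, ξ)`: for `t > 0` the minimal energy of a trajectory that ends in `ξ`
at time `t`, and `‖ξ - x₀‖²_{Γ⁻¹}` at `t = 0`. -/
def value (S : UncertainSystem n m r ι) (y : ℝ → E r) (k : ι) (t : ℝ) (ξ : E n) : ℝ :=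
  if 0 < t then
    sInf {c : ℝ | ∃ (x : ℝ → E n) (v : ℝ → E m), S.Admissible k t ξ x v ∧ c = S.cost y k t x v}
  else sqNorm (S.Γ k)⁻¹ (ξ - S.x₀)

end UncertainSystem

section Risk

variable {ι : Type*} [Fintype ι] [Nonempty ι]

/-- Expectation under the uniform distribution on the finite parameter set. -/
def expectation (X : ι → ℝ) : ℝ := (1 / (Fintype.card ι : ℝ)) * ∑ k, X k

/-- The worst case: the maximum over the finite parameter set. -/
def worstCase (X : ι → ℝ) : ℝ := Finset.univ.sup' Finset.univ_nonempty X

/-- The entropic risk measure `ρ_θ(X) = θ⁻¹ ln 𝔼[exp(θ X)]`. -/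
def entropicRisk (θ : ℝ) (X : ι → ℝ) : ℝ :=
  (1 / θ) * Real.log (expectation fun k => Real.exp (θ * X k))

end Risk

/-- The minimizer of `f` over `ℝⁿ` (meaningful when there is exactly one). -/
def argmin {n : ℕ} (f : E n → ℝ) : E n := Classical.epsilon fun x => ∀ z, f x ≤ f z

namespace UncertainSystem

variable {n m r : ℕ} {ι : Type*} [Fintype ι] [Nonempty ι]

/-- `x̂_0(t)`, the minimizer of the expected energy. -/
def xhatZero (S : UncertainSystem n m r ι) (y : ℝ → E r) (t : ℝ) : E n :=
  argmin fun x => expectation fun k => S.value y k t x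

/-- `x̂_∞(t)`, the minimizer of the worst case energy. -/
def xhatInfty (S : UncertainSystem n m r ι) (y : ℝ → E r) (t : ℝ) : E n :=
  argmin fun x => worstCase fun k => S.value y k t x

/-- `x̂_θ(t)`, the minimizer of the entropic risk of the energy with risk aversion `θ > 0`. -/
def xhat (S : UncertainSystem n m r ι) (y : ℝ → E r) (θ t : ℝ) : E n :=
  argmin fun x => entropicRisk θ fun k => S.value y k t x

end UncertainSystem

end RiskAverseKalman

end

/-! Each value function `𝒱_k(t, ·)` is a quadratic polynomial whose coefficients are absolutely
continuous in `t` and whose leading part is bounded below uniformly on `[0, T]`. The reason is that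
the minimal energy is attained on an extremal of the Hamiltonian system. Extremals depend affinely
on the initial error `η`, and the map from `η` to the end state is invertible
(`LQProblem.X_injective`). Convexity makes every extremal optimal (`LQProblem.totalCost_ext_le`), so
the value is the energy at `η = Y(t)(ξ - z(t))` (`value_eq_quadEval`).

For small `θ`, the minimizers solve `∑ exp(θ 𝒱_k) ∇𝒱_k = 0`. At `θ = 0` this is exactly the
condition for the mean, so the limit is an ordinary parameter value. The linearization in `ξ` is
invertible by strong convexity, so the implicit function theorem makes the minimizer a locally
smooth function of `θ` and the coefficients. Its time derivative is a factor jointly continuous in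
`(θ, t)` applied to the fixed integrable derivative of the coefficients. Uniform continuity on
compact sets then gives convergence in `W^{1,1}` (`tendsto_normW11_zero`).

For large `θ`, the entropic risk lies below the maximum by at most `ln N / θ`. The maximum is
strongly convex, so the minimizers differ by `O(θ^{-1/2})` uniformly in `t`
(`norm_argmin_entropicRisk_sub_le`), which gives convergence in `L^p`. -/

noncomputable section

namespace RiskAverseKalman

/-! ### Absolutely continuous curves and their calculus. -/

section Primitive

variable {F G : Type*} [NormedAddCommGroup F] [NormedSpace ℝ F]
  [NormedAddCommGroup G] [NormedSpace ℝ G]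

/-- `u` is an absolutely continuous function on `[0, T]` with integrable derivative `g`. -/
structure IsPrimitive (T : ℝ) (u g : ℝ → F) : Prop where
  integrable : IntegrableOn g (Ioc 0 T)
  eq : ∀ t ∈ Icc 0 T, u t = u 0 + ∫ s in (0 : ℝ)..t, g s

theorem intervalIntegrable_of_Ioc {F : Type*} [NormedAddCommGroup F] {T s t : ℝ} {g : ℝ → F}
    (hg : IntegrableOn g (Ioc 0 T)) (hs : s ∈ Icc 0 T) (ht : t ∈ Icc 0 T) : IntervalIntegrable g volume s t := by
  rw [intervalIntegrable_iff]
  refine hg.mono_set ?_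
  intro x hx
  rw [mem_uIoc] at hx
  rcases hx with h | h
  · exact ⟨hs.1.trans_lt h.1, h.2.trans ht.2⟩
  · exact ⟨ht.1.trans_lt h.1, h.2.trans hs.2⟩

theorem continuousOn_primitive_Icc {T : ℝ} {g : ℝ → F} (hg : IntegrableOn g (Ioc 0 T)) :
    ContinuousOn (fun t => ∫ s in (0 : ℝ)..t, g s) (Icc 0 T) := by
  rcases lt_or_ge T 0 with h | h
  · simp [Icc_eq_empty_of_lt h]
  have := intervalIntegral.continuousOn_primitive_interval' (μ := volume) (f := g) (a := 0)
    (b₁ := 0) (b₂ := T) (intervalIntegrable_of_Ioc hg ⟨le_rfl, h⟩ ⟨h, le_rfl⟩) (by simp)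
  rwa [uIcc_of_le h] at this

namespace IsPrimitive

variable {T : ℝ} {u g : ℝ → F}

theorem sub_eq (h : IsPrimitive T u g) {s t : ℝ} (hs : s ∈ Icc 0 T) (ht : t ∈ Icc 0 T) :
    u t - u s = ∫ τ in s..t, g τ := by
  have h0 : (0 : ℝ) ∈ Icc 0 T := ⟨le_rfl, hs.1.trans hs.2⟩
  rw [h.eq t ht, h.eq s hs, ← intervalIntegral.integral_interval_sub_left
    (intervalIntegrable_of_Ioc h.integrable h0 ht) (intervalIntegrable_of_Ioc h.integrable h0 hs)]
  abel

theorem continuousOn (h : IsPrimitive T u g) : ContinuousOn u (Icc 0 T) :=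
  (continuousOn_const.add (continuousOn_primitive_Icc h.integrable)).congr h.eq

theorem mono (h : IsPrimitive T u g) {t : ℝ} (ht : t ≤ T) : IsPrimitive t u g :=
  ⟨h.integrable.mono_set (Ioc_subset_Ioc_right ht), fun s hs => h.eq s ⟨hs.1, hs.2.trans ht⟩⟩

theorem norm_sub_le (h : IsPrimitive T u g) {s t : ℝ} (hs : 0 ≤ s) (hst : s ≤ t) (ht : t ≤ T) :
    ‖u t - u s‖ ≤ ∫ τ in s..t, ‖g τ‖ := by
  rw [h.sub_eq ⟨hs, hst.trans ht⟩ ⟨hs.trans hst, ht⟩]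
  exact intervalIntegral.norm_integral_le_integral_norm hst

theorem of_primitive (hg : IntegrableOn g (Ioc 0 T)) (c : F) :
    IsPrimitive T (fun t => c + ∫ s in (0 : ℝ)..t, g s) g :=
  ⟨hg, fun t _ => by simp⟩

theorem congr_deriv (h : IsPrimitive T u g) {g' : ℝ → F} (hg : ∀ t, g' t = g t) :
    IsPrimitive T u g' := by
  have : g' = g := funext hg
  rwa [this]

theorem of_hasDerivAt [CompleteSpace F] (hu : ∀ t ∈ Icc 0 T, HasDerivAt u (g t) t)
    (hg : ContinuousOn g (Icc 0 T)) :
    IsPrimitive T u g := by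
  have hi : IntegrableOn g (Ioc 0 T) :=
    (hg.integrableOn_compact isCompact_Icc).mono_set Ioc_subset_Icc_self
  refine ⟨hi, fun t ht => ?_⟩
  rw [intervalIntegral.integral_eq_sub_of_hasDerivAt]
  · abel
  · intro x hx
    rw [uIcc_of_le ht.1] at hx
    exact hu x ⟨hx.1, hx.2.trans ht.2⟩
  · exact intervalIntegrable_of_Ioc hi ⟨le_rfl, ht.1.trans ht.2⟩ ht

theorem add (h : IsPrimitive T u g) {v k : ℝ → F} (h' : IsPrimitive T v k) :
    IsPrimitive T (fun t => u t + v t) (fun t => g t + k t) := by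
  refine ⟨h.integrable.add h'.integrable, fun t ht => ?_⟩
  have h0 : (0 : ℝ) ∈ Icc 0 T := ⟨le_rfl, ht.1.trans ht.2⟩
  rw [intervalIntegral.integral_add (intervalIntegrable_of_Ioc h.integrable h0 ht)
    (intervalIntegrable_of_Ioc h'.integrable h0 ht), h.eq t ht, h'.eq t ht]
  abel

theorem clm [CompleteSpace F] [CompleteSpace G] (h : IsPrimitive T u g) (L : F →L[ℝ] G) :
    IsPrimitive T (fun t => L (u t)) (fun t => L (g t)) := by
  refine ⟨L.integrable_comp h.integrable, fun t ht => ?_⟩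
  have h0 : (0 : ℝ) ∈ Icc 0 T := ⟨le_rfl, ht.1.trans ht.2⟩
  rw [h.eq t ht, map_add, L.intervalIntegral_comp_comm
    (intervalIntegrable_of_Ioc h.integrable h0 ht)]

theorem sub [CompleteSpace F] (h : IsPrimitive T u g) {v k : ℝ → F} (h' : IsPrimitive T v k) :
    IsPrimitive T (fun t => u t - v t) (fun t => g t - k t) := by
  have := h.add (h'.clm (-ContinuousLinearMap.id ℝ F))
  simpa [sub_eq_add_neg] using this

theorem prodMk [CompleteSpace F] [CompleteSpace G] (h : IsPrimitive T u g) {v k : ℝ → G}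
    (h' : IsPrimitive T v k) :
    IsPrimitive T (fun t => (u t, v t)) (fun t => (g t, k t)) := by
  have := (h.clm (ContinuousLinearMap.inl ℝ F G)).add (h'.clm (ContinuousLinearMap.inr ℝ F G))
  simpa using this

theorem pi {ι : Type*} [Fintype ι] [CompleteSpace F] {u g : ι → ℝ → F}
    (h : ∀ i, IsPrimitive T (u i) (g i)) :
    IsPrimitive T (fun t i => u i t) (fun t i => g i t) := by
  have hi : IntegrableOn (fun t i => g i t) (Ioc 0 T) :=
    Integrable.of_eval fun i => (h i).integrable
  refine ⟨hi, fun t ht => ?_⟩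
  have h0 : (0 : ℝ) ∈ Icc 0 T := ⟨le_rfl, ht.1.trans ht.2⟩
  funext i
  have := (ContinuousLinearMap.proj (R := ℝ) (φ := fun _ : ι => F) i).intervalIntegral_comp_comm
    (intervalIntegrable_of_Ioc hi h0 ht)
  simp only [ContinuousLinearMap.proj_apply] at this
  rw [Pi.add_apply, ← this, (h i).eq t ht]

end IsPrimitive

/-- Continuous induction: the set of good times is closed, contains `0` and extends to the right of
each of its points. This mean value inequality lets the chain rule avoid differentiation almost
everywhere. -/
theorem norm_sub_le_of_locally {F : Type*} [NormedAddCommGroup F] {T : ℝ} {e : ℝ → F} {h : ℝ → ℝ}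
    (he : ContinuousOn e (Icc 0 T)) (hh : ContinuousOn h (Icc 0 T))
    (hloc : ∀ t ∈ Ico 0 T, ∀ᶠ s in 𝓝[>] t, ‖e s - e t‖ ≤ h s - h t) :
    ∀ t ∈ Icc 0 T, ‖e t - e 0‖ ≤ h t - h 0 := by
  rcases lt_or_ge T 0 with hT | hT
  · simp [Icc_eq_empty_of_lt hT]
  have key : Icc 0 T ⊆ {t | ‖e t - e 0‖ ≤ h t - h 0} := by
    refine IsClosed.Icc_subset_of_forall_mem_nhdsWithin ?_ (by simp) ?_
    · have := isClosed_Icc.isClosed_le (he.sub (continuousOn_const (c := e 0))).norm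
        (hh.sub (continuousOn_const (c := h 0)))
      convert this using 1
      ext x
      exact and_comm
    · rintro t ⟨ht, htI⟩
      filter_upwards [hloc t htI] with s hs
      have : e s - e 0 = (e s - e t) + (e t - e 0) := by abel
      simp only [mem_ofPred_eq] at ht ⊢
      rw [this]
      linarith [norm_add_le (e s - e t) (e t - e 0)]
  exact key

theorem integrableOn_clm_apply {T : ℝ} {g : ℝ → F} (hg : IntegrableOn g (Ioc 0 T))
    {L : ℝ → F →L[ℝ] G} (hL : ContinuousOn L (Icc 0 T)) :
    IntegrableOn (fun t => L t (g t)) (Ioc 0 T) := by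
  obtain ⟨K, hK⟩ := isCompact_Icc.exists_bound_of_continuousOn hL
  have hLm : AEStronglyMeasurable L (volume.restrict (Ioc 0 T)) :=
    (hL.aestronglyMeasurable_of_isCompact isCompact_Icc measurableSet_Icc).mono_measure
      (Measure.restrict_mono Ioc_subset_Icc_self le_rfl)
  refine Integrable.mono' (hg.norm.const_mul K) ?_ ?_
  · exact (ContinuousLinearMap.apply ℝ G : F →L[ℝ] (F →L[ℝ] G) →L[ℝ] G).aestronglyMeasurable_comp₂
      hg.aestronglyMeasurable hLm
  · filter_upwards [ae_restrict_mem measurableSet_Ioc] with t ht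
    exact (L t).le_of_opNorm_le (hK t ⟨ht.1.le, ht.2⟩) _

/-- The chain rule for absolutely continuous curves. -/
theorem IsPrimitive.chain [CompleteSpace F] [CompleteSpace G] {T : ℝ} {a a' : ℝ → F} {u : ℝ → G}
    {L : ℝ → F →L[ℝ] G} (ha : IsPrimitive T a a') (hL : ContinuousOn L (Icc 0 T))
    (hu : ∀ t ∈ Icc 0 T, ∃ f : F → G, HasStrictFDerivAt f (L t) (a t) ∧
      ∀ᶠ s in 𝓝[Icc 0 T] t, u s = f (a s)) :
    IsPrimitive T u (fun t => L t (a' t)) := by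
  have hint := integrableOn_clm_apply ha.integrable hL
  refine ⟨hint, ?_⟩
  have hucont : ContinuousOn u (Icc 0 T) := by
    intro t ht
    -- The outer function `f` may change with `t`, as suits functions known only locally from the
    -- implicit function theorem.
    obtain ⟨f, hf, hfu⟩ := hu t ht
    exact (hf.continuousAt.comp_continuousWithinAt (ha.continuousOn t ht)).congr_of_eventuallyEq
      hfu (hfu.self_of_nhdsWithin ht)
  have hn : IntegrableOn (fun t => ‖a' t‖) (Ioc 0 T) := ha.integrable.norm
  set e : ℝ → G := fun t => u t - ∫ s in (0 : ℝ)..t, L s (a' s) with he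
  set h : ℝ → ℝ := fun t => ∫ s in (0 : ℝ)..t, ‖a' s‖ with hh
  have hec : ContinuousOn e (Icc 0 T) := hucont.sub (continuousOn_primitive_Icc hint)
  have hhc : ContinuousOn h (Icc 0 T) := continuousOn_primitive_Icc hn
  -- The defect `e` is shown to be constant. Near `t`, one half of `ε` pays for the linearization
  -- error of `f` and the other half for replacing `L τ` by `L t`; both are measured against `∫
  -- ‖a'‖`.
  have key : ∀ ε > 0, ∀ t ∈ Icc 0 T, ‖e t - e 0‖ ≤ ε * h t := by
    intro ε hε
    have := norm_sub_le_of_locally (T := T) (e := e) (h := fun t => ε * h t) hec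
      (continuousOn_const.mul hhc) ?_
    · simpa [hh] using this
    intro t ht
    have htI : t ∈ Icc 0 T := ⟨ht.1, ht.2.le⟩
    have h0 : (0 : ℝ) ∈ Icc 0 T := ⟨le_rfl, ht.1.trans ht.2.le⟩
    obtain ⟨f, hf, hfu⟩ := hu t htI
    have hle : 𝓝[>] t ≤ 𝓝[Icc 0 T] t := by
      rw [← nhdsWithin_Ioo_eq_nhdsGT ht.2]
      exact nhdsWithin_mono _ fun x hx => ⟨ht.1.trans hx.1.le, hx.2.le⟩
    have hder : ∀ᶠ s in 𝓝[Icc 0 T] t, ‖f (a s) - f (a t) - L t (a s - a t)‖ ≤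
        ε / 2 * ‖a s - a t‖ :=
      (ha.continuousOn t htI).eventually
        ((hf.hasFDerivAt.isLittleO).bound (half_pos hε))
    have hLt : ∀ᶠ s in 𝓝[Icc 0 T] t, ‖L s - L t‖ ≤ ε / 2 := by
      have := (hL t htI).eventually (Metric.closedBall_mem_nhds (L t) (half_pos hε))
      simpa [dist_eq_norm] using this
    obtain ⟨δ, hδ, hball⟩ := Metric.mem_nhdsWithin_iff.1 hLt
    have hball' : ∀ᶠ s in 𝓝[>] t, s < t + δ ∧ s < T := by
      filter_upwards [Ioo_mem_nhdsGT (lt_min (lt_add_of_pos_right t hδ) ht.2)] with s hs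
      exact ⟨hs.2.trans_le (min_le_left _ _), hs.2.trans_le (min_le_right _ _)⟩
    filter_upwards [hle hfu, hle hder, hball', self_mem_nhdsWithin] with s hus hs hsb hts
    have hts : t < s := hts
    have hsI : s ∈ Icc 0 T := ⟨ht.1.trans hts.le, hsb.2.le⟩
    have hb := ha.norm_sub_le ht.1 hts.le hsb.2.le
    have hsub := ha.sub_eq htI hsI
    have hI1 := intervalIntegrable_of_Ioc hint h0 hsI
    have hI2 := intervalIntegrable_of_Ioc hint h0 htI
    have hI3 := intervalIntegrable_of_Ioc hint htI hsI
    have hI4 := intervalIntegrable_of_Ioc ha.integrable htI hsI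
    have hN1 := intervalIntegrable_of_Ioc hn h0 hsI
    have hN2 := intervalIntegrable_of_Ioc hn h0 htI
    have e1 : h s - h t = ∫ τ in t..s, ‖a' τ‖ := by
      simp only [hh]
      rw [intervalIntegral.integral_interval_sub_left hN1 hN2]
    have hut : u t = f (a t) := hfu.self_of_nhdsWithin htI
    have hLI : IntervalIntegrable (fun τ => L t (a' τ)) volume t s :=
      ⟨(L t).integrable_comp hI4.1, (L t).integrable_comp hI4.2⟩
    have e2 : e s - e t = (f (a s) - f (a t) - L t (a s - a t)) -
        ∫ τ in t..s, (L τ - L t) (a' τ) := by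
      simp only [he, sub_apply]
      rw [intervalIntegral.integral_sub hI3 hLI, hsub, (L t).intervalIntegral_comp_comm hI4, hus,
        hut, ← intervalIntegral.integral_interval_sub_left hI1 hI2]
      abel
    have e3 : ‖∫ τ in t..s, (L τ - L t) (a' τ)‖ ≤ ε / 2 * ∫ τ in t..s, ‖a' τ‖ := by
      rw [← intervalIntegral.integral_const_mul]
      refine intervalIntegral.norm_integral_le_of_norm_le hts.le ?_
        ((intervalIntegrable_of_Ioc hn htI hsI).const_mul _)
      refine Eventually.of_forall fun τ hτ => ?_
      refine (L τ - L t).le_of_opNorm_le (hball ⟨?_, ?_⟩) _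
      · rw [Metric.mem_ball, Real.dist_eq, abs_lt]
        constructor <;> linarith [hτ.1, hτ.2, hsb.1]
      · exact ⟨ht.1.trans hτ.1.le, hτ.2.trans hsI.2⟩
    rw [e2, ← mul_sub, e1]
    refine (_root_.norm_sub_le _ _).trans ?_
    have := mul_le_mul_of_nonneg_left hb (half_pos hε).le
    linarith
  intro t ht
  have hz : ‖e t - e 0‖ ≤ 0 := by
    refine le_of_forall_pos_le_add fun ε hε => ?_
    have hht : 0 ≤ h t := intervalIntegral.integral_nonneg ht.1 fun _ _ => norm_nonneg _
    have := key (ε / (h t + 1)) (by positivity) t ht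
    refine this.trans ?_
    rw [zero_add, div_mul_eq_mul_div, div_le_iff₀ (by positivity)]
    nlinarith
  have := sub_eq_zero.1 (norm_le_zero_iff.1 hz)
  simp only [he, intervalIntegral.integral_same, sub_zero] at this
  rw [← this]
  abel

theorem IsPrimitive.comp_contDiff [CompleteSpace F] [CompleteSpace G] {T : ℝ} {a a' : ℝ → F}
    (ha : IsPrimitive T a a') {f : F → G} (hf : ContDiff ℝ 1 f) :
    IsPrimitive T (fun t => f (a t)) (fun t => fderiv ℝ f (a t) (a' t)) :=
  ha.chain ((hf.continuous_fderiv one_ne_zero).comp_continuousOn ha.continuousOn)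
    fun _ _ => ⟨f, hf.contDiffAt.hasStrictFDerivAt one_ne_zero, Eventually.of_forall fun _ => rfl⟩

/-- The product rule for a bounded bilinear map. -/
theorem IsPrimitive.bilin {K : Type*} [NormedAddCommGroup K] [NormedSpace ℝ K]
    [CompleteSpace F] [CompleteSpace G] [CompleteSpace K] {T : ℝ} {u u' : ℝ → F}
    {v v' : ℝ → G} (b : F →L[ℝ] G →L[ℝ] K) (hu : IsPrimitive T u u') (hv : IsPrimitive T v v') :
    IsPrimitive T (fun t => b (u t) (v t)) (fun t => b (u t) (v' t) + b (u' t) (v t)) := by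
  have hb := b.isBoundedBilinearMap
  refine ((hu.prodMk hv).comp_contDiff (f := fun p : F × G => b p.1 p.2) hb.contDiff).congr_deriv ?_
  intro t
  rw [(hb.hasFDerivAt _).fderiv]
  rfl

theorem IsPrimitive.inner {K : Type*} [NormedAddCommGroup K] [InnerProductSpace ℝ K]
    [CompleteSpace K] {T : ℝ} {u u' v v' : ℝ → K} (hu : IsPrimitive T u u')
    (hv : IsPrimitive T v v') :
    IsPrimitive T (fun t => inner ℝ (u t) (v t))
      (fun t => inner ℝ (u t) (v' t) + inner ℝ (u' t) (v t)) :=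
  hu.bilin (innerSL ℝ) hv

end Primitive

/-! ### Weak derivatives versus absolutely continuous representatives. -/

section WeakDerivative

variable {d : ℕ} {T : ℝ} {u g : ℝ → E d}

theorem integral_Ioo_eq_interval {F : Type*} [NormedAddCommGroup F] [NormedSpace ℝ F] {a b : ℝ}
    (hab : a ≤ b) (f : ℝ → F) : ∫ s in Ioo a b, f s = ∫ s in a..b, f s := by
  rw [intervalIntegral.integral_of_le hab, integral_Ioc_eq_integral_Ioo]

theorem eq_zero_of_tsupport_subset {φ : ℝ → ℝ} {s : Set ℝ} (hφ : tsupport φ ⊆ s) {x : ℝ}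
    (hx : x ∉ s) : φ x = 0 := by
  by_contra h
  exact hx (hφ (subset_tsupport φ h))

/-- Integration by parts: apply the product rule to `φ • u`, which vanishes at both endpoints. -/
theorem IsPrimitive.hasWeakDeriv (hT : 0 ≤ T) (h : IsPrimitive T u g) : HasWeakDeriv 0 T u g := by
  refine ⟨(h.continuousOn.mono Ioo_subset_Icc_self).locallyIntegrableOn measurableSet_Ioo,
    (h.integrable.mono_set Ioo_subset_Ioc_self).locallyIntegrableOn, fun φ hφ _ hsupp => ?_⟩
  have hφ1 : ContDiff ℝ 1 φ := hφ.of_le (by exact_mod_cast le_top)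
  have hp : IsPrimitive T φ (deriv φ) :=
    .of_hasDerivAt (fun t _ => (hφ1.differentiable one_ne_zero t).hasDerivAt)
      (hφ1.continuous_deriv le_rfl).continuousOn
  have hb := hp.bilin (ContinuousLinearMap.lsmul ℝ ℝ : ℝ →L[ℝ] E d →L[ℝ] E d) h
  have h0 : (0 : ℝ) ∈ Icc 0 T := ⟨le_rfl, hT⟩
  have hTT : T ∈ Icc 0 T := ⟨hT, le_rfl⟩
  have e := hb.sub_eq h0 hTT
  simp only [ContinuousLinearMap.lsmul_apply] at e
  rw [eq_zero_of_tsupport_subset hsupp (x := 0) (by simp),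
    eq_zero_of_tsupport_subset hsupp (x := T) (by simp)] at e
  have i1 : IntervalIntegrable (fun t => φ t • g t) volume 0 T :=
    (intervalIntegrable_of_Ioc h.integrable h0 hTT).continuousOn_smul hφ.continuous.continuousOn
  have i2 : IntervalIntegrable (fun t => deriv φ t • u t) volume 0 T := by
    refine ContinuousOn.intervalIntegrable ?_
    rw [uIcc_of_le hT]
    exact (hφ1.continuous_deriv le_rfl).continuousOn.smul h.continuousOn
  rw [intervalIntegral.integral_add i1 i2] at e
  rw [integral_Ioo_eq_interval hT, integral_Ioo_eq_interval hT]
  simp only [zero_smul, sub_zero] at e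
  rw [eq_neg_iff_add_eq_zero, add_comm]
  exact e.symm

/-- A smooth nondecreasing function that increases from `0` to `1` on `[s, s + δ]`. -/
def ramp (s δ : ℝ) (τ : ℝ) : ℝ := Real.smoothTransition ((τ - s) / δ)

theorem contDiff_ramp (s δ : ℝ) : ContDiff ℝ ∞ (ramp s δ) :=
  Real.smoothTransition.contDiff.comp ((contDiff_id.sub contDiff_const).div_const δ)

theorem ramp_of_le {s δ τ : ℝ} (hδ : 0 < δ) (h : τ ≤ s) : ramp s δ τ = 0 :=
  Real.smoothTransition.zero_of_nonpos (div_nonpos_of_nonpos_of_nonneg (sub_nonpos.2 h) hδ.le)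

theorem ramp_of_ge {s δ τ : ℝ} (hδ : 0 < δ) (h : s + δ ≤ τ) : ramp s δ τ = 1 :=
  Real.smoothTransition.one_of_one_le ((one_le_div hδ).2 (by linarith))

theorem deriv_ramp_nonneg {s δ : ℝ} (hδ : 0 < δ) (τ : ℝ) : 0 ≤ deriv (ramp s δ) τ := by
  refine Monotone.deriv_nonneg fun a b hab => Real.smoothTransition.monotone ?_
  gcongr

theorem continuous_deriv_ramp (s δ : ℝ) : Continuous (deriv (ramp s δ)) :=
  (contDiff_ramp s δ).continuous_deriv (by exact_mod_cast le_top)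

theorem deriv_ramp_eq_zero {s δ τ : ℝ} (hδ : 0 < δ) (h : τ ∉ Icc s (s + δ)) :
    deriv (ramp s δ) τ = 0 := by
  have : τ < s ∨ s + δ < τ := by
    by_contra! hc
    exact h ⟨hc.1, hc.2⟩
  rcases this with h | h
  · have : ramp s δ =ᶠ[𝓝 τ] fun _ => 0 := by
      filter_upwards [Iio_mem_nhds h] with x hx using ramp_of_le hδ (le_of_lt hx)
    rw [this.deriv_eq, deriv_const]
  · have : ramp s δ =ᶠ[𝓝 τ] fun _ => 1 := by
      filter_upwards [Ioi_mem_nhds h] with x hx using ramp_of_ge hδ (le_of_lt hx)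
    rw [this.deriv_eq, deriv_const]

theorem integral_deriv_ramp {s δ : ℝ} (hδ : 0 < δ) :
    ∫ τ in s..(s + δ), deriv (ramp s δ) τ = 1 := by
  rw [intervalIntegral.integral_eq_sub_of_hasDerivAt
    (fun x _ => ((contDiff_ramp s δ).differentiable (by simp) x).hasDerivAt)
    ((continuous_deriv_ramp s δ).intervalIntegrable _ _), ramp_of_ge hδ le_rfl,
    ramp_of_le hδ le_rfl, sub_zero]

/-- The derivative of the ramp is nonnegative, has mass one and is supported in `[s, s + δ]`, so
integrating against it averages `v` near `s`. -/
theorem norm_integral_deriv_ramp_smul_sub_le {v : ℝ → E d} {s δ ε : ℝ} (hδ : 0 < δ)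
    (hs : Icc s (s + δ) ⊆ Ioo 0 T) (hv : ContinuousOn v (Ioo 0 T))
    (hε : ∀ τ ∈ Icc s (s + δ), ‖v τ - v s‖ ≤ ε) :
    ‖(∫ τ in Ioo 0 T, deriv (ramp s δ) τ • v τ) - v s‖ ≤ ε := by
  have hle : s ≤ s + δ := by linarith
  have e1 : ∫ τ in Ioo 0 T, deriv (ramp s δ) τ • v τ =
      ∫ τ in s..(s + δ), deriv (ramp s δ) τ • v τ := by
    rw [intervalIntegral.integral_of_le hle, ← integral_Icc_eq_integral_Ioc]
    refine setIntegral_eq_of_subset_of_forall_sdiff_eq_zero measurableSet_Ioo hs ?_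
    intro x hx
    rw [deriv_ramp_eq_zero hδ hx.2, zero_smul]
  have hc := continuous_deriv_ramp s δ
  have i1 : IntervalIntegrable (fun τ => deriv (ramp s δ) τ • v τ) volume s (s + δ) := by
    refine ContinuousOn.intervalIntegrable ?_
    rw [uIcc_of_le hle]
    exact hc.continuousOn.smul (hv.mono hs)
  have i2 : IntervalIntegrable (fun τ => deriv (ramp s δ) τ • v s) volume s (s + δ) :=
    (hc.smul continuous_const).intervalIntegrable _ _
  have e2 : v s = ∫ τ in s..(s + δ), deriv (ramp s δ) τ • v s := by
    rw [intervalIntegral.integral_smul_const, integral_deriv_ramp hδ, one_smul]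
  rw [e1, show ∀ w : E d, w - v s = w - ∫ τ in s..(s + δ), deriv (ramp s δ) τ • v s from
    fun w => by rw [← e2], ← intervalIntegral.integral_sub i1 i2]
  have e3 : ε = ∫ τ in s..(s + δ), deriv (ramp s δ) τ * ε := by
    rw [intervalIntegral.integral_mul_const, integral_deriv_ramp hδ, one_mul]
  rw [e3]
  refine intervalIntegral.norm_integral_le_of_norm_le hle ?_
    ((hc.mul continuous_const).intervalIntegrable _ _)
  refine Eventually.of_forall fun τ hτ => ?_
  rw [← smul_sub, norm_smul, Real.norm_of_nonneg (deriv_ramp_nonneg hδ τ)]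
  exact mul_le_mul_of_nonneg_left (hε τ ⟨hτ.1.le, hτ.2⟩) (deriv_ramp_nonneg hδ τ)

/-- The lemma of du Bois-Reymond for continuous functions. -/
theorem eq_of_integral_deriv_smul_eq_zero {v : ℝ → E d} (hv : ContinuousOn v (Ioo 0 T))
    (h : ∀ φ : ℝ → ℝ, ContDiff ℝ ∞ φ → HasCompactSupport φ → tsupport φ ⊆ Ioo 0 T →
      ∫ s in Ioo 0 T, deriv φ s • v s = 0)
    {s t : ℝ} (hs : s ∈ Ioo 0 T) (ht : t ∈ Ioo 0 T) : v s = v t := by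
  wlog hst : s ≤ t generalizing s t
  · exact (this ht hs (le_of_not_ge hst)).symm
  rw [← sub_eq_zero, ← norm_le_zero_iff]
  refine le_of_forall_pos_le_add fun ε hε => ?_
  have near : ∀ r ∈ Ioo 0 T, ∃ δ > 0, ∀ τ ∈ Icc r (r + δ), τ ∈ Ioo 0 T ∧ ‖v τ - v r‖ ≤ ε / 2 := by
    intro r hr
    have h1 : ∀ᶠ τ in 𝓝 r, τ ∈ Ioo 0 T ∧ ‖v τ - v r‖ ≤ ε / 2 := by
      refine Filter.Eventually.and (Ioo_mem_nhds hr.1 hr.2) ?_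
      have := (hv.continuousAt (Ioo_mem_nhds hr.1 hr.2)).eventually
        (Metric.closedBall_mem_nhds (v r) (half_pos hε))
      simpa [dist_eq_norm] using this
    obtain ⟨δ, hδ, hb⟩ := Metric.eventually_nhds_iff.1 h1
    refine ⟨δ / 2, half_pos hδ, fun τ hτ => hb ?_⟩
    rw [Real.dist_eq, abs_lt]
    constructor <;> linarith [hτ.1, hτ.2]
  obtain ⟨δ₁, hδ₁, h₁⟩ := near s hs
  obtain ⟨δ₂, hδ₂, h₂⟩ := near t ht
  set δ := min δ₁ δ₂ with hδdef
  have hδ : 0 < δ := lt_min hδ₁ hδ₂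
  have h₁' : ∀ τ ∈ Icc s (s + δ), τ ∈ Ioo 0 T ∧ ‖v τ - v s‖ ≤ ε / 2 := fun τ hτ =>
    h₁ τ ⟨hτ.1, hτ.2.trans (by linarith [min_le_left δ₁ δ₂])⟩
  have h₂' : ∀ τ ∈ Icc t (t + δ), τ ∈ Ioo 0 T ∧ ‖v τ - v t‖ ≤ ε / 2 := fun τ hτ =>
    h₂ τ ⟨hτ.1, hτ.2.trans (by linarith [min_le_right δ₁ δ₂])⟩
  have b₁ := norm_integral_deriv_ramp_smul_sub_le hδ (fun τ hτ => (h₁' τ hτ).1) hv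
    fun τ hτ => (h₁' τ hτ).2
  have b₂ := norm_integral_deriv_ramp_smul_sub_le hδ (fun τ hτ => (h₂' τ hτ).1) hv
    fun τ hτ => (h₂' τ hτ).2
  -- The difference of two ramps is an admissible test function, and its derivative compares the
  -- average of `v` near `s` with that near `t`.
  have hsub : tsupport (fun τ => ramp s δ τ - ramp t δ τ) ⊆ Icc s (t + δ) := by
    refine closure_minimal ?_ isClosed_Icc
    intro τ hτ
    by_contra hc
    have : τ < s ∨ t + δ < τ := by
      by_contra! hc'
      exact hc ⟨hc'.1, hc'.2⟩
    rw [Function.mem_support] at hτ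
    rcases this with hlt | hlt
    · exact hτ (by rw [ramp_of_le hδ hlt.le, ramp_of_le hδ (hlt.le.trans hst), sub_zero])
    · exact hτ (by rw [ramp_of_ge hδ hlt.le, ramp_of_ge hδ (by linarith), sub_self])
  have hend : t + δ < T := (h₂' (t + δ) ⟨by linarith, le_rfl⟩).1.2
  have hz := h _ ((contDiff_ramp s δ).sub (contDiff_ramp t δ))
    (HasCompactSupport.of_support_subset_isCompact isCompact_Icc
      ((subset_tsupport _).trans hsub))
    (hsub.trans fun τ hτ => ⟨hs.1.trans_le hτ.1, hτ.2.trans_lt hend⟩)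
  have hint : ∀ r ∈ Ioo 0 T, Icc r (r + δ) ⊆ Ioo 0 T →
      IntegrableOn (fun τ => deriv (ramp r δ) τ • v τ) (Ioo 0 T) := by
    intro r hr hsub
    have : IntegrableOn (fun τ => deriv (ramp r δ) τ • v τ) (Icc r (r + δ)) :=
      ((continuous_deriv_ramp r δ).continuousOn.smul (hv.mono hsub)).integrableOn_compact
        isCompact_Icc
    refine this.of_forall_sdiff_eq_zero measurableSet_Ioo fun x hx => ?_
    rw [deriv_ramp_eq_zero hδ hx.2, zero_smul]
  have hd : ∀ τ, deriv (fun τ => ramp s δ τ - ramp t δ τ) τ • v τ =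
      deriv (ramp s δ) τ • v τ - deriv (ramp t δ) τ • v τ := by
    intro τ
    rw [deriv_fun_sub ((contDiff_ramp s δ).differentiable (by simp) τ)
      ((contDiff_ramp t δ).differentiable (by simp) τ), sub_smul]
  rw [integral_congr_ae (Eventually.of_forall hd), integral_sub
    (hint s hs fun τ hτ => (h₁' τ hτ).1) (hint t ht fun τ hτ => (h₂' τ hτ).1), sub_eq_zero] at hz
  rw [hz] at b₁
  set w := ∫ τ in Ioo 0 T, deriv (ramp t δ) τ • v τ
  have : v s - v t = (w - v t) - (w - v s) := by abel
  rw [this]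
  linarith [norm_sub_le (w - v t) (w - v s)]

theorem integrable_deriv_smul {φ : ℝ → ℝ} (hφ : ContDiff ℝ ∞ φ) {v : ℝ → E d}
    (hv : ContinuousOn v (Icc 0 T)) : IntegrableOn (fun s => deriv φ s • v s) (Ioo 0 T) :=
  (((hφ.continuous_deriv (by exact_mod_cast le_top)).continuousOn.smul hv).integrableOn_compact
    isCompact_Icc).mono_set Ioo_subset_Icc_self

/-- The difference between `u` and the primitive of `g` has weak derivative zero, so du Bois-Reymond
makes it constant on `(0, T)` and continuity extends this to `[0, T]`. -/
theorem isPrimitive_of_hasWeakDeriv (hT : 0 < T) (hu : ContinuousOn u (Icc 0 T))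
    (hw : HasWeakDeriv 0 T u g) (hg : IntegrableOn g (Ioc 0 T)) : IsPrimitive T u g := by
  have hG : IsPrimitive T (fun t => (0 : E d) + ∫ s in (0 : ℝ)..t, g s) g := .of_primitive hg 0
  have hGw := hG.hasWeakDeriv hT.le
  set G : ℝ → E d := fun t => (0 : E d) + ∫ s in (0 : ℝ)..t, g s with hGdef
  have hv : ContinuousOn (fun t => u t - G t) (Icc 0 T) := hu.sub hG.continuousOn
  have hz : ∀ φ : ℝ → ℝ, ContDiff ℝ ∞ φ → HasCompactSupport φ → tsupport φ ⊆ Ioo 0 T →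
      ∫ s in Ioo 0 T, deriv φ s • (u s - G s) = 0 := by
    intro φ h1 h2 h3
    simp only [smul_sub]
    rw [integral_sub (integrable_deriv_smul h1 hu) (integrable_deriv_smul h1 hG.continuousOn),
      hw.2.2 φ h1 h2 h3, hGw.2.2 φ h1 h2 h3, sub_self]
  have hmid : T / 2 ∈ Ioo 0 T := ⟨by linarith, by linarith⟩
  have hconst : ∀ t ∈ Icc 0 T, u t - G t = u (T / 2) - G (T / 2) := by
    have : EqOn (fun t => u t - G t) (fun _ => u (T / 2) - G (T / 2)) (Ioo 0 T) := fun t ht =>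
      eq_of_integral_deriv_smul_eq_zero (hv.mono Ioo_subset_Icc_self) hz ht hmid
    exact this.of_subset_closure hv continuousOn_const Ioo_subset_Icc_self
      (by rw [closure_Ioo hT.ne])
  refine ⟨hg, fun t ht => ?_⟩
  have e1 := hconst t ht
  have e2 := hconst 0 ⟨le_rfl, hT.le⟩
  rw [← e2] at e1
  simp only [hGdef, intervalIntegral.integral_same, zero_add, sub_zero] at e1
  rw [← e1]
  abel

/-- By the fundamental lemma of the calculus of variations. Hence the arbitrary choice in
`weakDeriv` does not affect norms. -/
theorem HasWeakDeriv.ae_eq {g' : ℝ → E d} (h : HasWeakDeriv 0 T u g)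
    (h' : HasWeakDeriv 0 T u g') : g =ᵐ[volume.restrict (Ioo 0 T)] g' := by
  have key := isOpen_Ioo.ae_eq_zero_of_integral_contDiff_smul_eq_zero (μ := volume)
    (h.2.1.sub h'.2.1) ?_
  · rw [EventuallyEq, ae_restrict_iff' measurableSet_Ioo]
    filter_upwards [key] with x hx hxI using sub_eq_zero.1 (hx hxI)
  intro φ h1 h2 h3
  have e : ∀ k : ℝ → E d, LocallyIntegrableOn k (Ioo 0 T) →
      IntegrableOn (fun s => φ s • k s) (Ioo 0 T) := by
    intro k hk
    have hkK : IntegrableOn k (tsupport φ) := hk.integrableOn_compact_subset h3 h2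
    have : IntegrableOn (fun s => φ s • k s) (tsupport φ) :=
      hkK.continuousOn_smul h1.continuous.continuousOn h2
    refine this.of_forall_sdiff_eq_zero measurableSet_Ioo fun x hx => ?_
    rw [image_eq_zero_of_notMem_tsupport hx.2, zero_smul]
  rw [← setIntegral_eq_integral_of_forall_compl_eq_zero (s := Ioo 0 T)]
  · simp only [Pi.sub_apply, smul_sub]
    rw [integral_sub (e g h.2.1) (e g' h'.2.1), sub_eq_zero, ← neg_inj, ← h.2.2 φ h1 h2 h3,
      ← h'.2.2 φ h1 h2 h3]
  · intro x hx
    rw [eq_zero_of_tsupport_subset h3 hx, zero_smul]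

theorem HasWeakDeriv.weakDeriv_ae_eq (h : HasWeakDeriv 0 T u g) :
    weakDeriv 0 T u =ᵐ[volume.restrict (Ioo 0 T)] g :=
  HasWeakDeriv.ae_eq (Classical.epsilon_spec (p := fun g => HasWeakDeriv 0 T u g) ⟨g, h⟩) h

theorem memLp_of_continuousOn {F : Type*} [NormedAddCommGroup F] {p : ℝ≥0∞} {f : ℝ → F}
    (hf : ContinuousOn f (Icc 0 T)) : MemLp f p (volume.restrict (Ioo 0 T)) := by
  obtain ⟨K, hK⟩ := isCompact_Icc.exists_bound_of_continuousOn hf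
  refine MemLp.of_bound ((hf.aestronglyMeasurable_of_isCompact isCompact_Icc
    measurableSet_Icc).mono_measure (Measure.restrict_mono Ioo_subset_Icc_self le_rfl)) K ?_
  filter_upwards [ae_restrict_mem measurableSet_Ioo] with t ht using hK t (Ioo_subset_Icc_self ht)

theorem IsPrimitive.memW1 (hT : 0 ≤ T) (h : IsPrimitive T u g) : MemW1 1 0 T u :=
  ⟨memLp_of_continuousOn h.continuousOn, g,
    memLp_one_iff_integrable.2 (h.integrable.mono_set Ioo_subset_Ioc_self), h.hasWeakDeriv hT⟩

theorem IsPrimitive.normW11_eq (hT : 0 ≤ T) (h : IsPrimitive T u g) :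
    normW11 0 T u = normLp 1 0 T u + normLp 1 0 T g := by
  rw [normW11, normLp, normLp, normLp, eLpNorm_congr_ae (h.hasWeakDeriv hT).weakDeriv_ae_eq]

end WeakDerivative

/-! ### Flows of linear autonomous equations. -/

section LinearFlow

variable {K : Type*} [NormedAddCommGroup K] [NormedSpace ℝ K]

/-- The flow of the linear differential equation `dz/dt = L z`. -/
def linearFlow (L : K →L[ℝ] K) (t : ℝ) : K →L[ℝ] K := NormedSpace.exp (t • L)

variable (L : K →L[ℝ] K)

theorem linearFlow_zero : linearFlow L 0 = ContinuousLinearMap.id ℝ K := by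
  rw [linearFlow, zero_smul, NormedSpace.exp_zero]
  rfl

variable [CompleteSpace K]

theorem hasDerivAt_linearFlow (t : ℝ) : HasDerivAt (linearFlow L) (L ∘L linearFlow L t) t :=
  hasDerivAt_exp_smul_const' L t

theorem continuous_linearFlow : Continuous (linearFlow L) :=
  continuous_iff_continuousAt.2 fun t => (hasDerivAt_linearFlow L t).continuousAt

theorem linearFlow_linearFlow_neg (t : ℝ) (z : K) : linearFlow L t (linearFlow L (-t) z) = z := by
  let : NormedAlgebra ℚ (K →L[ℝ] K) := NormedAlgebra.restrictScalars ℚ ℝ _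
  have h := NormedSpace.exp_add_of_commute (Commute.neg_right (Commute.refl (t • L)))
  rw [add_neg_cancel, NormedSpace.exp_zero, ← neg_smul] at h
  exact (DFunLike.congr_fun h z).symm

theorem isPrimitive_linearFlow (T : ℝ) :
    IsPrimitive T (linearFlow L) (fun t => L ∘L linearFlow L t) :=
  .of_hasDerivAt (fun t _ => hasDerivAt_linearFlow L t)
    (continuous_const.clm_comp (continuous_linearFlow L)).continuousOn

end LinearFlow

theorem integrable_inner_of_memLp {K α : Type*} [NormedAddCommGroup K] [InnerProductSpace ℝ K]
    [MeasurableSpace α] {μ : Measure α} {f g : α → K} (hf : MemLp f 2 μ) (hg : MemLp g 2 μ) :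
    Integrable (fun x => inner ℝ (f x) (g x)) μ :=
  (hf.norm.integrable_mul hg.norm).mono' (hf.1.inner hg.1)
    (Eventually.of_forall fun _ => norm_inner_le_norm _ _)

/-! ### The linear-quadratic problem for one parameter: extremals, optimality and minimal cost. -/

section LinearQuadratic

open ContinuousLinearMap (adjoint)

variable {H U Z : Type*} [NormedAddCommGroup H] [InnerProductSpace ℝ H]
  [NormedAddCommGroup U] [InnerProductSpace ℝ U]
  [NormedAddCommGroup Z] [InnerProductSpace ℝ Z]

/-- The data of a linear-quadratic estimation problem with state equation `dx/dt = A x + B v`,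
output `C x`, initial guess `x₀` and weights `W`, `Ri = R⁻¹` and `Q` for the initial error, the
disturbance and the output error. -/
structure LQProblem (H U Z : Type*) [NormedAddCommGroup H] [InnerProductSpace ℝ H]
    [NormedAddCommGroup U] [InnerProductSpace ℝ U]
    [NormedAddCommGroup Z] [InnerProductSpace ℝ Z] where
  A : H →L[ℝ] H
  B : U →L[ℝ] H
  C : H →L[ℝ] Z
  W : H →L[ℝ] H
  R : U →L[ℝ] U
  Ri : U →L[ℝ] U
  Q : Z →L[ℝ] Z
  x₀ : H
  γ : ℝ
  γ_pos : 0 < γ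
  W_coercive : ∀ h, γ * ‖h‖ ^ 2 ≤ inner ℝ h (W h)
  W_symm : ∀ a b, inner ℝ (W a) b = inner ℝ a (W b)
  Ri_R : ∀ u, Ri (R u) = u
  Ri_symm : ∀ a b, inner ℝ (Ri a) b = inner ℝ a (Ri b)
  Ri_nonneg : ∀ a, 0 ≤ inner ℝ a (Ri a)
  Q_symm : ∀ a b, inner ℝ (Q a) b = inner ℝ a (Q b)
  Q_nonneg : ∀ a, 0 ≤ inner ℝ a (Q a)

namespace LQProblem

variable (S : LQProblem H U Z)

theorem R_symm (a b : U) : inner ℝ (S.R a) b = inner ℝ a (S.R b) := by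
  conv_lhs => rw [← S.Ri_R b, ← S.Ri_symm, S.Ri_R]

theorem R_nonneg (a : U) : 0 ≤ inner ℝ (S.R a) a := by
  have := S.Ri_nonneg (S.R a)
  rwa [S.Ri_R] at this

/-- The running cost. -/
def running (z : Z) (x : H) (v : U) : ℝ :=
  inner ℝ v (S.Ri v) + inner ℝ (z - S.C x) (S.Q (z - S.C x))

theorem integrable_running {μ : Measure ℝ} {y : ℝ → Z} {x : ℝ → H} {v : ℝ → U} (hy : MemLp y 2 μ)
    (hx : MemLp x 2 μ) (hv : MemLp v 2 μ) :
    Integrable (fun s => S.running (y s) (x s) (v s)) μ := by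
  have h1 := hy.sub (S.C.comp_memLp' hx)
  exact (integrable_inner_of_memLp hv (S.Ri.comp_memLp' hv)).add
    (integrable_inner_of_memLp h1 (S.Q.comp_memLp' h1))

variable [FiniteDimensional ℝ H] [FiniteDimensional ℝ U] [FiniteDimensional ℝ Z]

/-- The Hamiltonian matrix of the problem, acting on pairs of a state and a costate. -/
def ham : (H × H) →L[ℝ] (H × H) :=
  ((S.A ∘L .fst ℝ H H) + (S.B ∘L S.R ∘L adjoint S.B) ∘L .snd ℝ H H).prod
    (-(adjoint S.A ∘L .snd ℝ H H) + (adjoint S.C ∘L S.Q ∘L S.C) ∘L .fst ℝ H H)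

theorem ham_apply (z : H × H) :
    S.ham z = (S.A z.1 + S.B (S.R (adjoint S.B z.2)),
      -adjoint S.A z.2 + adjoint S.C (S.Q (S.C z.1))) := rfl

/-- The Hamiltonian flow. -/
def flow (t : ℝ) : (H × H) →L[ℝ] (H × H) := linearFlow S.ham t

theorem continuous_flow : Continuous S.flow := continuous_linearFlow S.ham

theorem flow_zero : S.flow 0 = ContinuousLinearMap.id ℝ (H × H) := linearFlow_zero S.ham

theorem flow_flow_neg (t : ℝ) (z : H × H) : S.flow t (S.flow (-t) z) = z :=
  linearFlow_linearFlow_neg S.ham t z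

theorem isPrimitive_flow (T : ℝ) : IsPrimitive T S.flow (fun t => S.ham ∘L S.flow t) :=
  isPrimitive_linearFlow S.ham T

/-- The fundamental solution with initial values `(η, W η)`. -/
def fund (t : ℝ) : H →L[ℝ] (H × H) := S.flow t ∘L (ContinuousLinearMap.id ℝ H).prod S.W

/-- The state component of the fundamental solution. -/
def X (t : ℝ) : H →L[ℝ] H := .fst ℝ H H ∘L S.fund t

/-- The costate component of the fundamental solution. -/
def Lam (t : ℝ) : H →L[ℝ] H := .snd ℝ H H ∘L S.fund t

theorem X_apply (t : ℝ) (η : H) : S.X t η = (S.flow t (η, S.W η)).1 := rfl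

theorem Lam_apply (t : ℝ) (η : H) : S.Lam t η = (S.flow t (η, S.W η)).2 := rfl

theorem continuous_X : Continuous S.X :=
  continuous_const.clm_comp (S.continuous_flow.clm_comp continuous_const)

theorem continuous_Lam : Continuous S.Lam :=
  continuous_const.clm_comp (S.continuous_flow.clm_comp continuous_const)

theorem isPrimitive_flow_apply (T : ℝ) (z : H × H) :
    IsPrimitive T (fun t => S.flow t z) (fun t => S.ham (S.flow t z)) :=
  (S.isPrimitive_flow T).clm (ContinuousLinearMap.apply ℝ (H × H) z)

theorem isPrimitive_X (T : ℝ) : IsPrimitive T S.X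
    (fun t => .fst ℝ H H ∘L (S.ham ∘L S.flow t) ∘L (ContinuousLinearMap.id ℝ H).prod S.W) :=
  (S.isPrimitive_flow T).clm
    ((ContinuousLinearMap.compL ℝ H (H × H) H (.fst ℝ H H)) ∘L
      ((ContinuousLinearMap.compL ℝ H (H × H) (H × H)).flip
        ((ContinuousLinearMap.id ℝ H).prod S.W)))

/-- The left side is the derivative of `⟨x, λ⟩` along the homogeneous Hamiltonian flow. The terms
with `A` cancel and a nonnegative quantity remains. -/
theorem inner_hamiltonian (x l : H) :
    inner ℝ x (-adjoint S.A l + adjoint S.C (S.Q (S.C x))) +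
      inner ℝ (S.A x + S.B (S.R (adjoint S.B l))) l =
    inner ℝ (S.C x) (S.Q (S.C x)) + inner ℝ (S.R (adjoint S.B l)) (adjoint S.B l) := by
  simp only [inner_add_right, inner_add_left, inner_neg_right,
    ContinuousLinearMap.adjoint_inner_right]
  ring

/-- If the state vanishes at time `t`, so does `⟨x, λ⟩`. This pairing is nondecreasing and starts at
`⟨η, W η⟩ ≥ γ ‖η‖²`, so `η = 0`. -/
theorem X_injective {t : ℝ} (ht : 0 ≤ t) : Function.Injective (S.X t) := by
  rw [injective_iff_map_eq_zero]
  intro η hη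
  have hz := S.isPrimitive_flow_apply t (η, S.W η)
  have hi := (hz.clm (.fst ℝ H H)).inner (hz.clm (.snd ℝ H H))
  have e := hi.eq t ⟨ht, le_rfl⟩
  have hX : (S.flow t (η, S.W η)).1 = 0 := hη
  have hnn : 0 ≤ ∫ s in (0 : ℝ)..t,
      (inner ℝ (S.flow s (η, S.W η)).1 (S.ham (S.flow s (η, S.W η))).2 +
        inner ℝ (S.ham (S.flow s (η, S.W η))).1 (S.flow s (η, S.W η)).2) := by
    refine intervalIntegral.integral_nonneg ht fun s _ => ?_
    rw [S.ham_apply, S.inner_hamiltonian]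
    exact add_nonneg (S.Q_nonneg _) (S.R_nonneg _)
  simp only [ContinuousLinearMap.coe_fst', ContinuousLinearMap.coe_snd', hX,
    inner_zero_left, S.flow_zero, ContinuousLinearMap.id_apply] at e
  have h1 := S.W_coercive η
  have h2 : ‖η‖ ^ 2 ≤ 0 := by
    by_contra! hc
    have := mul_pos S.γ_pos hc
    linarith
  have h3 : ‖η‖ = 0 := by nlinarith [norm_nonneg η]
  exact norm_eq_zero.1 h3

theorem X_isInvertible {t : ℝ} (ht : 0 ≤ t) : (S.X t).IsInvertible := by
  let e : H ≃ₗ[ℝ] H := LinearEquiv.ofInjectiveEndo (S.X t : H →ₗ[ℝ] H) (S.X_injective ht)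
  exact ⟨e.toContinuousLinearEquiv, by ext; rfl⟩

/-- The inverse of the state component of the fundamental solution. -/
def Y (t : ℝ) : H →L[ℝ] H := (S.X t).inverse

theorem X_Y {t : ℝ} (ht : 0 ≤ t) (h : H) : S.X t (S.Y t h) = h :=
  (S.X_isInvertible ht).self_apply_inverse h

/-- Operator inversion is smooth at invertible operators, so the chain rule applies along `X`. -/
theorem exists_isPrimitive_Y (T : ℝ) : ∃ Y', IsPrimitive T S.Y Y' := by
  refine ⟨_, (S.isPrimitive_X T).chain (u := S.Y)
    (L := fun t => fderiv ℝ ContinuousLinearMap.inverse (S.X t)) ?_ ?_⟩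
  · intro t ht
    have h1 : ContDiffAt ℝ 2 (ContinuousLinearMap.inverse : (H →L[ℝ] H) → (H →L[ℝ] H)) (S.X t) :=
      (S.X_isInvertible ht.1).contDiffAt_map_inverse
    have h2 := (h1.fderiv_right (m := 1) (by norm_num)).continuousAt
    exact (h2.comp (S.continuous_X.continuousAt (x := t))).continuousWithinAt
  · intro t ht
    refine ⟨ContinuousLinearMap.inverse, ?_, Eventually.of_forall fun _ => rfl⟩
    exact ((S.X_isInvertible ht.1).contDiffAt_map_inverse (n := 1)).hasStrictFDerivAt one_ne_zero

variable {T : ℝ} {y : ℝ → Z}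

/-- The inhomogeneity of the Hamiltonian system. -/
def source (y : ℝ → Z) (s : ℝ) : H × H := (0, adjoint S.C (S.Q (y s)))

/-- The solution of the inhomogeneous Hamiltonian system with initial values `(x₀, 0)`. -/
def part (y : ℝ → Z) (t : ℝ) : H × H :=
  S.flow t ((S.x₀, 0) + ∫ s in (0 : ℝ)..t, -S.flow (-s) (S.source y s))

/-- Variation of constants. -/
theorem isPrimitive_part (hy : IntegrableOn y (Ioc 0 T)) :
    IsPrimitive T (S.part y) (fun t => S.ham (S.part y t) - S.source y t) := by
  have hs : IntegrableOn (S.source y) (Ioc 0 T) :=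
    (ContinuousLinearMap.inr ℝ H H ∘L adjoint S.C ∘L S.Q).integrable_comp hy
  have hi : IntegrableOn (fun s => -S.flow (-s) (S.source y s)) (Ioc 0 T) :=
    (integrableOn_clm_apply hs (S.continuous_flow.comp continuous_neg).continuousOn).neg
  refine ((S.isPrimitive_flow T).bilin (ContinuousLinearMap.id ℝ _)
    (IsPrimitive.of_primitive hi (S.x₀, 0))).congr_deriv fun t => ?_
  simp only [ContinuousLinearMap.id_apply, map_neg, S.flow_flow_neg, part]
  rw [ContinuousLinearMap.comp_apply]
  abel

theorem part_zero : S.part y 0 = (S.x₀, 0) := by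
  simp [part, S.flow_zero]

/-- The extremal with initial values `(x₀ + η, W η)`. -/
def ext (y : ℝ → Z) (η : H) (t : ℝ) : H × H := S.part y t + S.flow t (η, S.W η)

theorem ext_zero (η : H) : S.ext y η 0 = (S.x₀ + η, S.W η) := by
  simp [ext, S.part_zero, S.flow_zero]

theorem isPrimitive_ext (hy : IntegrableOn y (Ioc 0 T)) (η : H) :
    IsPrimitive T (S.ext y η) (fun t => S.ham (S.ext y η t) - S.source y t) := by
  refine ((S.isPrimitive_part hy).add (S.isPrimitive_flow_apply T _)).congr_deriv fun t => ?_
  simp only [ext, map_add]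
  abel

/-- The disturbance that belongs to an extremal. -/
def control (y : ℝ → Z) (η : H) (t : ℝ) : U := S.R (adjoint S.B (S.ext y η t).2)

theorem isPrimitive_ext_fst (hy : IntegrableOn y (Ioc 0 T)) (η : H) :
    IsPrimitive T (fun t => (S.ext y η t).1)
      (fun t => S.A (S.ext y η t).1 + S.B (S.control y η t)) := by
  refine ((S.isPrimitive_ext hy η).clm (.fst ℝ H H)).congr_deriv fun t => ?_
  simp [ham_apply, source, control]

theorem isPrimitive_ext_snd (hy : IntegrableOn y (Ioc 0 T)) (η : H) :
    IsPrimitive T (fun t => (S.ext y η t).2)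
      (fun t => -adjoint S.A (S.ext y η t).2 -
        adjoint S.C (S.Q (y t - S.C (S.ext y η t).1))) := by
  refine ((S.isPrimitive_ext hy η).clm (.snd ℝ H H)).congr_deriv fun t => ?_
  simp only [ham_apply, source, ContinuousLinearMap.coe_snd', map_sub]
  abel

/-- The cost of a trajectory on `[0, t]`. -/
def totalCost (y : ℝ → Z) (t : ℝ) (x : ℝ → H) (v : ℝ → U) : ℝ :=
  inner ℝ (x 0 - S.x₀) (S.W (x 0 - S.x₀)) + ∫ s in (0 : ℝ)..t, S.running (y s) (x s) (v s)

-- The running cost is a convex quadratic and so lies above its tangent at `(x', R B* l)`; there the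
-- gradient in `v` is `2 B* l` because `Ri` inverts `R`.
set_option linter.unusedSectionVars false in
theorem running_ge (z : Z) (x x' : H) (v : U) (l : H) :
    S.running z x' (S.R (adjoint S.B l)) +
      2 * (inner ℝ l (S.B (v - S.R (adjoint S.B l))) -
        inner ℝ (S.Q (z - S.C x')) (S.C (x - x'))) ≤ S.running z x v := by
  set w := v - S.R (adjoint S.B l) with hw
  have hv : v = S.R (adjoint S.B l) + w := by rw [hw]; abel
  set δ := x - x' with hδ
  have hx : z - S.C x = (z - S.C x') - S.C δ := by rw [hδ, map_sub]; abel
  rw [running, running, hx, hv]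
  have h1 := S.Ri_nonneg w
  have h2 := S.Q_nonneg (S.C δ)
  have h3 : inner ℝ (S.R (adjoint S.B l)) (S.Ri w) = inner ℝ l (S.B w) := by
    rw [← S.Ri_symm, S.Ri_R, ContinuousLinearMap.adjoint_inner_left]
  have h4 : inner ℝ w (adjoint S.B l) = inner ℝ l (S.B w) := by
    rw [ContinuousLinearMap.adjoint_inner_right, real_inner_comm]
  have h5 : inner ℝ (S.C δ) (S.Q (z - S.C x')) = inner ℝ (S.Q (z - S.C x')) (S.C δ) :=
    real_inner_comm _ _
  have h6 : inner ℝ (z - S.C x') (S.Q (S.C δ)) = inner ℝ (S.Q (z - S.C x')) (S.C δ) :=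
    (S.Q_symm _ _).symm
  set p := z - S.C x'
  set q := S.C δ
  simp only [map_add, map_sub, inner_add_left, inner_add_right, inner_sub_left, inner_sub_right,
    S.Ri_R, h3, h4, h5, h6]
  linarith

theorem restrict_Ioo_Ioc (t : ℝ) :
    (volume : Measure ℝ).restrict (Ioo 0 t) = volume.restrict (Ioc 0 t) :=
  restrict_Ioo_eq_restrict_Ioc

/-- Integrate the tangent inequality. The costate equation turns the linear term into twice the
derivative of `⟨λ, x - x'⟩`, where `x'` is the extremal state. The boundary term at `t` vanishes
because the end states agree; the one at `0` cancels the linear term of the initial cost because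
`λ(0) = W η`. -/
theorem totalCost_ext_le {t : ℝ} (ht : 0 ≤ t) (hy : MemLp y 2 (volume.restrict (Ioo 0 t)))
    {x : ℝ → H} {v : ℝ → U} (hx : IsPrimitive t x (fun s => S.A (x s) + S.B (v s)))
    (hv : MemLp v 2 (volume.restrict (Ioo 0 t))) {η : H} (hη : x t = (S.ext y η t).1) :
    S.totalCost y t (fun s => (S.ext y η s).1) (S.control y η) ≤ S.totalCost y t x v := by
  have hy1 : IntegrableOn y (Ioc 0 t) := by
    rw [IntegrableOn, ← restrict_Ioo_Ioc]
    exact hy.integrable one_le_two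
  have h1 := S.isPrimitive_ext_fst hy1 η
  have h2 := S.isPrimitive_ext_snd hy1 η
  have hvc : ContinuousOn (S.control y η) (Icc 0 t) :=
    (S.R ∘L adjoint S.B).continuous.comp_continuousOn h2.continuousOn
  have hb := h2.inner (hx.sub h1)
  have htt : t ∈ Icc 0 t := ⟨ht, le_rfl⟩
  have h0 : (0 : ℝ) ∈ Icc 0 t := ⟨le_rfl, ht⟩
  have hd : ∀ s, inner ℝ (S.ext y η s).2 (S.A (x s) + S.B (v s) -
        (S.A (S.ext y η s).1 + S.B (S.control y η s))) +
      inner ℝ (-adjoint S.A (S.ext y η s).2 - adjoint S.C (S.Q (y s - S.C (S.ext y η s).1)))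
        (x s - (S.ext y η s).1) =
      inner ℝ (S.ext y η s).2 (S.B (v s - S.R (adjoint S.B (S.ext y η s).2))) -
        inner ℝ (S.Q (y s - S.C (S.ext y η s).1)) (S.C (x s - (S.ext y η s).1)) := by
    intro s
    simp only [inner_sub_left, inner_neg_left,
      ContinuousLinearMap.adjoint_inner_left, control, map_sub, inner_add_right, inner_sub_right]
    ring
  have hcross := hb.integrable
  have e := hb.eq t htt
  simp only [hη, sub_self, inner_zero_right, S.ext_zero] at e
  rw [intervalIntegral.integral_congr (g := fun s =>
    inner ℝ (S.ext y η s).2 (S.B (v s - S.R (adjoint S.B (S.ext y η s).2))) -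
        inner ℝ (S.Q (y s - S.C (S.ext y η s).1)) (S.C (x s - (S.ext y η s).1)))
    (fun s _ => hd s)] at e
  have hci : IntervalIntegrable (fun s =>
    inner ℝ (S.ext y η s).2 (S.B (v s - S.R (adjoint S.B (S.ext y η s).2))) -
        inner ℝ (S.Q (y s - S.C (S.ext y η s).1)) (S.C (x s - (S.ext y η s).1))) volume 0 t := by
    refine intervalIntegrable_of_Ioc ?_ h0 htt
    simpa only [hd] using hcross
  have hr1 : IntervalIntegrable (fun s => S.running (y s) (S.ext y η s).1 (S.control y η s))
      volume 0 t := by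
    refine intervalIntegrable_of_Ioc ?_ h0 htt
    rw [IntegrableOn, ← restrict_Ioo_Ioc]
    exact S.integrable_running hy (memLp_of_continuousOn h1.continuousOn)
      (memLp_of_continuousOn hvc)
  have hr2 : IntervalIntegrable (fun s => S.running (y s) (x s) (v s)) volume 0 t := by
    refine intervalIntegrable_of_Ioc ?_ h0 htt
    rw [IntegrableOn, ← restrict_Ioo_Ioc]
    exact S.integrable_running hy (memLp_of_continuousOn hx.continuousOn) hv
  have hmono := intervalIntegral.integral_mono_on ht (hr1.add (hci.const_mul 2)) hr2
    (fun s _ => S.running_ge (y s) (x s) (S.ext y η s).1 (v s) (S.ext y η s).2)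
  rw [intervalIntegral.integral_add hr1 (hci.const_mul 2), intervalIntegral.integral_const_mul]
    at hmono
  have hx0 : x 0 - S.x₀ = η + (x 0 - (S.x₀ + η)) := by abel
  set δ := x 0 - (S.x₀ + η) with hδ
  have hW : 0 ≤ inner ℝ δ (S.W δ) :=
    (mul_nonneg S.γ_pos.le (sq_nonneg ‖δ‖)).trans (S.W_coercive δ)
  have hsym : inner ℝ δ (S.W η) = inner ℝ (S.W η) δ := real_inner_comm _ _
  have hsym2 : inner ℝ η (S.W δ) = inner ℝ (S.W η) δ := (S.W_symm _ _).symm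
  rw [totalCost, totalCost, hx0, S.ext_zero]
  simp only [add_sub_cancel_left, map_add, inner_add_left, inner_add_right, hsym, hsym2]
  linarith

/-- The quadratic coefficient of the running cost of an extremal as a function of `η`. -/
def runP (t : ℝ) : H →L[ℝ] H :=
  adjoint (adjoint S.B ∘L S.Lam t) ∘L S.R ∘L (adjoint S.B ∘L S.Lam t) +
    adjoint (S.C ∘L S.X t) ∘L S.Q ∘L (S.C ∘L S.X t)

/-- The linear coefficient of the running cost of an extremal as a function of `η`. -/
def runq (y : ℝ → Z) (t : ℝ) : H :=
  (2 : ℝ) • adjoint (adjoint S.B ∘L S.Lam t) (S.R (adjoint S.B (S.part y t).2)) -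
    (2 : ℝ) • adjoint (S.C ∘L S.X t) (S.Q (y t - S.C (S.part y t).1))

/-- The constant coefficient of the running cost of an extremal as a function of `η`. -/
def runc (y : ℝ → Z) (t : ℝ) : ℝ :=
  S.running (y t) (S.part y t).1 (S.R (adjoint S.B (S.part y t).2))

theorem inner_runP (t : ℝ) (η : H) : inner ℝ η (S.runP t η) =
    inner ℝ (S.R (adjoint S.B (S.Lam t η))) (adjoint S.B (S.Lam t η)) +
      inner ℝ (S.C (S.X t η)) (S.Q (S.C (S.X t η))) := by
  simp only [runP, add_apply, ContinuousLinearMap.comp_apply, inner_add_right,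
    ContinuousLinearMap.adjoint_inner_right, S.R_symm]

theorem running_ext (η : H) (t : ℝ) :
    S.running (y t) (S.ext y η t).1 (S.control y η t) =
      inner ℝ η (S.runP t η) + inner ℝ (S.runq y t) η + S.runc y t := by
  have hx : y t - S.C (S.ext y η t).1 = (y t - S.C (S.part y t).1) - S.C (S.X t η) := by
    simp only [ext, X_apply, Prod.fst_add, map_add]
    abel
  have hl : adjoint S.B (S.ext y η t).2 =
      adjoint S.B (S.part y t).2 + adjoint S.B (S.Lam t η) := by
    simp only [ext, Lam_apply, Prod.snd_add, map_add]
  rw [S.inner_runP, runq, runc, running, running, control, hx, hl]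
  set p := y t - S.C (S.part y t).1
  set q := S.C (S.X t η) with hq
  set b := adjoint S.B (S.part y t).2
  set c := adjoint S.B (S.Lam t η) with hc
  have h1 : inner ℝ (S.R c) b = inner ℝ (S.R b) c := by rw [S.R_symm, real_inner_comm]
  have h2 : inner ℝ q (S.Q p) = inner ℝ (S.Q p) q := real_inner_comm _ _
  have h3 : inner ℝ p (S.Q q) = inner ℝ (S.Q p) q := (S.Q_symm _ _).symm
  simp only [S.Ri_R, inner_sub_left, inner_smul_left, ContinuousLinearMap.adjoint_inner_left,
    ContinuousLinearMap.comp_apply, map_add, map_sub, inner_add_left, inner_add_right,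
    inner_sub_right, h1, h2, h3, ← hq, ← hc, RCLike.conj_to_real]
  ring

theorem continuous_runP : Continuous S.runP := by
  have h1 : Continuous fun t => adjoint S.B ∘L S.Lam t := continuous_const.clm_comp S.continuous_Lam
  have h2 : Continuous fun t => S.C ∘L S.X t := continuous_const.clm_comp S.continuous_X
  exact (((adjoint (𝕜 := ℝ) (E := H) (F := U)).continuous.comp h1).clm_comp
    (continuous_const.clm_comp h1)).add
    (((adjoint (𝕜 := ℝ) (E := H) (F := Z)).continuous.comp h2).clm_comp
    (continuous_const.clm_comp h2))

theorem integrable_runq (hy : IntegrableOn y (Ioc 0 T)) : IntegrableOn (S.runq y) (Ioc 0 T) := by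
  have h1 : Continuous fun t => adjoint S.B ∘L S.Lam t := continuous_const.clm_comp S.continuous_Lam
  have h2 : Continuous fun t => S.C ∘L S.X t := continuous_const.clm_comp S.continuous_X
  have hp := S.isPrimitive_part hy
  have i1 : IntegrableOn (fun t => S.R (adjoint S.B (S.part y t).2)) (Ioc 0 T) :=
    (((S.R ∘L adjoint S.B ∘L .snd ℝ H H).continuous.comp_continuousOn
      hp.continuousOn).integrableOn_compact isCompact_Icc).mono_set Ioc_subset_Icc_self
  have i2 : IntegrableOn (fun t => S.C (S.part y t).1) (Ioc 0 T) :=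
    (((S.C ∘L .fst ℝ H H).continuous.comp_continuousOn
      hp.continuousOn).integrableOn_compact isCompact_Icc).mono_set Ioc_subset_Icc_self
  have i3 : IntegrableOn (fun t => S.Q (y t - S.C (S.part y t).1)) (Ioc 0 T) :=
    S.Q.integrable_comp (hy.sub i2)
  exact ((integrableOn_clm_apply i1
    ((adjoint (𝕜 := ℝ) (E := H) (F := U)).continuous.comp h1).continuousOn).smul (2 : ℝ)).sub
    ((integrableOn_clm_apply i3
    ((adjoint (𝕜 := ℝ) (E := H) (F := Z)).continuous.comp h2).continuousOn).smul (2 : ℝ))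

theorem integrable_runc (hy : MemLp y 2 (volume.restrict (Ioo 0 T))) :
    IntegrableOn (S.runc y) (Ioc 0 T) := by
  have hy1 : IntegrableOn y (Ioc 0 T) := by
    rw [IntegrableOn, ← restrict_Ioo_Ioc]
    exact hy.integrable one_le_two
  have hp := S.isPrimitive_part hy1
  rw [IntegrableOn, ← restrict_Ioo_Ioc]
  exact S.integrable_running hy
    (memLp_of_continuousOn ((ContinuousLinearMap.fst ℝ H H).continuous.comp_continuousOn
      hp.continuousOn))
    (memLp_of_continuousOn ((S.R ∘L adjoint S.B ∘L .snd ℝ H H).continuous.comp_continuousOn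
      hp.continuousOn))

/-- The quadratic coefficient of the minimal cost as a function of `η`. -/
def cost2 (t : ℝ) : H →L[ℝ] H := S.W + ∫ s in (0 : ℝ)..t, S.runP s

/-- The linear coefficient of the minimal cost. -/
def cost1 (y : ℝ → Z) (t : ℝ) : H := 0 + ∫ s in (0 : ℝ)..t, S.runq y s

/-- The constant coefficient of the minimal cost. -/
def cost0 (y : ℝ → Z) (t : ℝ) : ℝ := 0 + ∫ s in (0 : ℝ)..t, S.runc y s

theorem isPrimitive_cost2 (T : ℝ) : IsPrimitive T S.cost2 S.runP :=
  .of_primitive ((S.continuous_runP.continuousOn.integrableOn_compact isCompact_Icc).mono_set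
    Ioc_subset_Icc_self) _

theorem isPrimitive_inner_cost2 (T : ℝ) (η : H) :
    IsPrimitive T (fun t => inner ℝ η (S.cost2 t η)) (fun t => inner ℝ η (S.runP t η)) :=
  (S.isPrimitive_cost2 T).clm (innerSL ℝ η ∘L ContinuousLinearMap.apply ℝ H η)

/-- The running cost only adds a nonnegative form to `W`. -/
theorem cost2_coercive {t : ℝ} (ht : 0 ≤ t) (η : H) :
    S.γ * ‖η‖ ^ 2 ≤ inner ℝ η (S.cost2 t η) := by
  rw [(S.isPrimitive_inner_cost2 t η).eq t ⟨ht, le_rfl⟩]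
  have : 0 ≤ ∫ s in (0 : ℝ)..t, inner ℝ η (S.runP s η) := by
    refine intervalIntegral.integral_nonneg ht fun s _ => ?_
    rw [S.inner_runP]
    exact add_nonneg (S.R_nonneg _) (S.Q_nonneg _)
  have h0 : S.cost2 0 = S.W := by simp [cost2]
  rw [h0]
  linarith [S.W_coercive η]

theorem totalCost_ext {t : ℝ} (ht : 0 ≤ t) (hy : MemLp y 2 (volume.restrict (Ioo 0 t))) (η : H) :
    S.totalCost y t (fun s => (S.ext y η s).1) (S.control y η) =
      inner ℝ η (S.cost2 t η) + inner ℝ (S.cost1 y t) η + S.cost0 y t := by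
  have hy1 : IntegrableOn y (Ioc 0 t) := by
    rw [IntegrableOn, ← restrict_Ioo_Ioc]
    exact hy.integrable one_le_two
  have h1 : IsPrimitive t (S.cost1 y) (S.runq y) := .of_primitive (S.integrable_runq hy1) 0
  have h1' : IsPrimitive t (fun s => inner ℝ (S.cost1 y s) η) (fun s => inner ℝ (S.runq y s) η) :=
    h1.clm ((innerSL ℝ).flip η)
  have h0 : IsPrimitive t (S.cost0 y) (S.runc y) := .of_primitive (S.integrable_runc hy) 0
  have := (((S.isPrimitive_inner_cost2 t η).add h1').add h0).eq t ⟨ht, le_rfl⟩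
  rw [this, totalCost, S.ext_zero]
  simp only [S.running_ext]
  simp [cost2, cost1, cost0]

end LQProblem

end LinearQuadratic

/-! ### Minimizers of mean, entropic risk and maximum of strongly convex quadratics. -/

section StronglyConvexQuadratic

variable {n : ℕ} {ι : Type*} [Fintype ι] [Nonempty ι]

/-- `φ` is a quadratic polynomial with leading part bounded below by `μ ‖·‖²`. -/
def StrongQuad (μ : ℝ) (φ : E n → ℝ) : Prop :=
  ∀ ξ h, ∃ β γ : ℝ, μ * ‖h‖ ^ 2 ≤ γ ∧ ∀ s : ℝ, φ (ξ + s • h) = φ ξ + β * s + γ * s ^ 2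

variable {μ : ℝ} {φ : E n → ℝ} {Φ : ι → E n → ℝ}

theorem fderiv_line {ξ h : E n} {β γ : ℝ} (hφ : Differentiable ℝ φ)
    (hq : ∀ s : ℝ, φ (ξ + s • h) = φ ξ + β * s + γ * s ^ 2) (s : ℝ) :
    fderiv ℝ φ (ξ + s • h) h = β + 2 * γ * s := by
  have h1 : HasDerivAt (fun s : ℝ => ξ + s • h) h s := by
    simpa using ((hasDerivAt_id s).smul_const h).const_add ξ
  have h2 := (hφ (ξ + s • h)).hasFDerivAt.comp_hasDerivAt s h1
  have h3 : HasDerivAt (fun s : ℝ => φ ξ + β * s + γ * s ^ 2) (β + 2 * γ * s) s := by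
    have := (((hasDerivAt_id s).const_mul β).const_add (φ ξ)).add
      (((hasDerivAt_id s).pow 2).const_mul γ)
    refine this.congr_deriv ?_
    simp
    ring
  have h4 : (φ ∘ fun s : ℝ => ξ + s • h) = fun s : ℝ => φ ξ + β * s + γ * s ^ 2 := funext hq
  rw [h4] at h2
  exact h2.unique h3

theorem StrongQuad.tendsto_cocompact (h : StrongQuad μ φ) (hμ : 0 < μ) (hφ : Differentiable ℝ φ) :
    Tendsto φ (cocompact (E n)) atTop := by
  have hlb : ∀ ξ, φ 0 + ‖ξ‖ * (μ * ‖ξ‖ - ‖fderiv ℝ φ 0‖) ≤ φ ξ := by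
    intro ξ
    obtain ⟨β, γ, hγ, hq⟩ := h 0 ξ
    have h0 := fderiv_line hφ hq 0
    have h1 := hq 1
    simp only [zero_smul, add_zero, mul_zero] at h0
    simp only [one_smul, zero_add, mul_one, one_pow] at h1
    have h2 : -(‖fderiv ℝ φ 0‖ * ‖ξ‖) ≤ fderiv ℝ φ 0 ξ :=
      (abs_le.1 ((fderiv ℝ φ 0).le_opNorm ξ)).1
    rw [h1, ← h0]
    nlinarith
  refine tendsto_atTop_mono hlb (tendsto_atTop_add_const_left _ _ ?_)
  have hn : Tendsto (fun ξ : E n => ‖ξ‖) (cocompact (E n)) atTop := tendsto_norm_cocompact_atTop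
  exact hn.atTop_mul_atTop₀ (tendsto_atTop_add_const_right _ _ (hn.const_mul_atTop hμ))

/-- Existence alone makes the choice in `argmin` a minimizer; uniqueness plays no role here. -/
theorem argmin_spec {F : E n → ℝ} (hF : Continuous F) (hc : Tendsto F (cocompact (E n)) atTop)
    (z : E n) : F (argmin F) ≤ F z :=
  Classical.epsilon_spec (p := fun x => ∀ z, F x ≤ F z) (hF.exists_forall_le hc) z

theorem StrongQuad.midpoint_le (h : StrongQuad μ φ) (x z : E n) :
    φ ((2 : ℝ)⁻¹ • (x + z)) ≤ (φ x + φ z) / 2 - μ / 4 * ‖z - x‖ ^ 2 := by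
  obtain ⟨β, γ, hγ, hq⟩ := h x (z - x)
  have h1 := hq 1
  have h2 := hq 2⁻¹
  have e : x + (2⁻¹ : ℝ) • (z - x) = (2 : ℝ)⁻¹ • (x + z) := by module
  rw [e] at h2
  simp only [one_smul, add_sub_cancel] at h1
  rw [h1, h2]
  nlinarith

theorem StrongQuad.expectation (h : ∀ k, StrongQuad μ (Φ k)) :
    StrongQuad μ (fun x => expectation fun k => Φ k x) := by
  intro ξ v
  choose β γ hγ hq using fun k => h k ξ v
  have hN : 0 < (Fintype.card ι : ℝ) := by exact_mod_cast Fintype.card_pos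
  refine ⟨RiskAverseKalman.expectation β, RiskAverseKalman.expectation γ, ?_, fun s => ?_⟩
  · rw [RiskAverseKalman.expectation, one_div, ← div_eq_inv_mul, le_div_iff₀ hN]
    have := Finset.sum_le_sum fun k (_ : k ∈ Finset.univ) => hγ k
    simp only [Finset.sum_const, Finset.card_univ, nsmul_eq_mul] at this
    linarith
  · simp only [RiskAverseKalman.expectation, hq, Finset.sum_add_distrib, ← Finset.sum_mul]
    ring

section Risk

theorem le_worstCase (X : ι → ℝ) (k : ι) : X k ≤ worstCase X :=
  Finset.le_sup' X (Finset.mem_univ k)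

theorem worstCase_le {X : ι → ℝ} {c : ℝ} (h : ∀ k, X k ≤ c) : worstCase X ≤ c :=
  Finset.sup'_le _ _ fun k _ => h k

theorem expectation_exp_pos (θ : ℝ) (X : ι → ℝ) : 0 < expectation fun k => Real.exp (θ * X k) := by
  have hN : 0 < (Fintype.card ι : ℝ) := by exact_mod_cast Fintype.card_pos
  have : 0 < ∑ k, Real.exp (θ * X k) :=
    Finset.sum_pos (fun k _ => Real.exp_pos _) Finset.univ_nonempty
  rw [expectation]
  positivity

theorem entropicRisk_le_worstCase {θ : ℝ} (hθ : 0 < θ) (X : ι → ℝ) :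
    entropicRisk θ X ≤ worstCase X := by
  have hN : 0 < (Fintype.card ι : ℝ) := by exact_mod_cast Fintype.card_pos
  rw [entropicRisk, one_div, ← div_eq_inv_mul, div_le_iff₀ hθ, Real.log_le_iff_le_exp
    (expectation_exp_pos θ X), expectation, one_div, ← div_eq_inv_mul, div_le_iff₀ hN]
  have := Finset.sum_le_sum fun k (_ : k ∈ (Finset.univ : Finset ι)) =>
    Real.exp_le_exp.2 (mul_le_mul_of_nonneg_left (le_worstCase X k) hθ.le)
  simp only [Finset.sum_const, Finset.card_univ, nsmul_eq_mul] at this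
  rwa [mul_comm (worstCase X), mul_comm (Real.exp _)]

/-- A single exponential is at most the whole sum, which is `N` times the mean; the factor `N` costs
`ln N / θ`. -/
theorem worstCase_le_entropicRisk {θ : ℝ} (hθ : 0 < θ) (X : ι → ℝ) :
    worstCase X ≤ entropicRisk θ X + Real.log (Fintype.card ι) / θ := by
  have hN : 0 < (Fintype.card ι : ℝ) := by exact_mod_cast Fintype.card_pos
  refine worstCase_le fun k => ?_
  have h1 : θ * X k - Real.log (Fintype.card ι) ≤
      Real.log (expectation fun k => Real.exp (θ * X k)) := by
    rw [Real.le_log_iff_exp_le (expectation_exp_pos θ X), Real.exp_sub, Real.exp_log hN,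
      expectation, one_div, ← div_eq_inv_mul]
    gcongr
    exact Finset.single_le_sum (f := fun k => Real.exp (θ * X k))
      (fun _ _ => (Real.exp_pos _).le) (Finset.mem_univ k)
  rw [entropicRisk, one_div, ← div_eq_inv_mul, ← add_div, le_div_iff₀ hθ]
  linarith

end Risk

theorem continuous_worstCase (hΦ : ∀ k, Continuous (Φ k)) :
    Continuous fun x => worstCase fun k => Φ k x :=
  Continuous.finset_sup'_apply _ fun k _ => hΦ k

theorem continuous_entropicRisk (θ : ℝ) (hΦ : ∀ k, Continuous (Φ k)) :
    Continuous fun x => entropicRisk θ fun k => Φ k x :=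
  continuous_const.mul ((continuous_const.mul (continuous_finsetSum _ fun k _ =>
    Real.continuous_exp.comp (continuous_const.mul (hΦ k)))).log
    fun _ => (expectation_exp_pos θ _).ne')

theorem worstCase_argmin_le (hμ : 0 < μ) (hd : ∀ k, Differentiable ℝ (Φ k))
    (hq : ∀ k, StrongQuad μ (Φ k)) (z : E n) :
    (worstCase fun k => Φ k (argmin fun x => worstCase fun k => Φ k x)) ≤
      worstCase fun k => Φ k z := by
  refine argmin_spec (F := fun x => worstCase fun k => Φ k x)
    (continuous_worstCase fun k => (hd k).continuous) ?_ z
  obtain ⟨k⟩ := ‹Nonempty ι›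
  exact tendsto_atTop_mono (fun x => le_worstCase (fun k => Φ k x) k)
    ((hq k).tendsto_cocompact hμ (hd k))

theorem entropicRisk_argmin_le (hμ : 0 < μ) (hd : ∀ k, Differentiable ℝ (Φ k))
    (hq : ∀ k, StrongQuad μ (Φ k)) {θ : ℝ} (hθ : 0 < θ) (z : E n) :
    (entropicRisk θ fun k => Φ k (argmin fun x => entropicRisk θ fun k => Φ k x)) ≤
      entropicRisk θ fun k => Φ k z := by
  refine argmin_spec (F := fun x => entropicRisk θ fun k => Φ k x)
    (continuous_entropicRisk θ fun k => (hd k).continuous) ?_ z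
  obtain ⟨k⟩ := ‹Nonempty ι›
  refine tendsto_atTop_mono (f := fun x => Φ k x + -(Real.log (Fintype.card ι) / θ)) (fun x => ?_)
    (tendsto_atTop_add_const_right _ _ ((hq k).tendsto_cocompact hμ (hd k)))
  have h1 := le_worstCase (fun k => Φ k x) k
  have h2 := worstCase_le_entropicRisk hθ (fun k => Φ k x)
  linarith

theorem expectation_argmin_le (hμ : 0 < μ) (hd : ∀ k, Differentiable ℝ (Φ k))
    (hq : ∀ k, StrongQuad μ (Φ k)) (z : E n) :
    (expectation fun k => Φ k (argmin fun x => expectation fun k => Φ k x)) ≤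
      expectation fun k => Φ k z := by
  have hD : Differentiable ℝ fun x => expectation fun k => Φ k x :=
    (Differentiable.fun_sum fun k _ => hd k).const_mul _
  exact argmin_spec (F := fun x => expectation fun k => Φ k x) hD.continuous
    ((StrongQuad.expectation hq).tendsto_cocompact hμ hD) z

/-- The minimizers of the entropic risk converge to those of the worst case at a uniform rate. -/
theorem norm_argmin_entropicRisk_sub_le (hμ : 0 < μ) (hd : ∀ k, Differentiable ℝ (Φ k))
    (hq : ∀ k, StrongQuad μ (Φ k)) {θ : ℝ} (hθ : 0 < θ) :
    ‖(argmin fun x => entropicRisk θ fun k => Φ k x) -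
      argmin fun x => worstCase fun k => Φ k x‖ ^ 2 ≤
        2 / μ * (Real.log (Fintype.card ι) / θ) := by
  set x := argmin fun x => worstCase fun k => Φ k x with hx
  set z := argmin fun x => entropicRisk θ fun k => Φ k x with hz
  -- Testing the minimality of `x` at the midpoint gives `μ/4 ‖z - x‖² ≤ (max at z - max at x) / 2`.
  -- The gap between the maxima is at most `ln N / θ`, by the two-sided bound on the risk and the
  -- minimality of `z`.
  have h1 := worstCase_argmin_le hμ hd hq ((2 : ℝ)⁻¹ • (x + z))
  have h2 : (worstCase fun k => Φ k ((2 : ℝ)⁻¹ • (x + z))) ≤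
      ((worstCase fun k => Φ k x) + worstCase fun k => Φ k z) / 2 - μ / 4 * ‖z - x‖ ^ 2 := by
    refine worstCase_le fun k => ((hq k).midpoint_le x z).trans ?_
    have a1 := le_worstCase (fun k => Φ k x) k
    have a2 := le_worstCase (fun k => Φ k z) k
    linarith
  have h3 := worstCase_le_entropicRisk hθ (fun k => Φ k z)
  have h4 := entropicRisk_argmin_le hμ hd hq hθ x
  have h5 := entropicRisk_le_worstCase hθ (fun k => Φ k x)
  rw [← hx] at h1
  rw [← hz] at h4
  rw [div_mul_eq_mul_div, le_div_iff₀ hμ]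
  linarith

/-- The first order condition for the minimizer of the entropic risk. -/
theorem sum_exp_smul_fderiv_argmin_entropicRisk (hμ : 0 < μ) (hd : ∀ k, Differentiable ℝ (Φ k))
    (hq : ∀ k, StrongQuad μ (Φ k)) {θ : ℝ} (hθ : 0 < θ) :
    ∑ k, Real.exp (θ * Φ k (argmin fun x => entropicRisk θ fun k => Φ k x)) •
      fderiv ℝ (Φ k) (argmin fun x => entropicRisk θ fun k => Φ k x) = 0 := by
  set z := argmin fun x => entropicRisk θ fun k => Φ k x with hz
  have hN : 0 < (Fintype.card ι : ℝ) := by exact_mod_cast Fintype.card_pos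
  -- The logarithm and the positive factors are monotone, so `z` also minimizes the plain sum of
  -- exponentials.
  have hmin : IsLocalMin (fun x => ∑ k, Real.exp (θ * Φ k x)) z := by
    refine Eventually.of_forall fun x => ?_
    have h := entropicRisk_argmin_le hμ hd hq hθ x
    rw [← hz, entropicRisk, entropicRisk, mul_le_mul_iff_right₀ (by positivity),
      Real.log_le_log_iff (expectation_exp_pos θ _) (expectation_exp_pos θ _), expectation,
      expectation, mul_le_mul_iff_right₀ (by positivity)] at h
    exact h
  have hder : HasFDerivAt (fun x => ∑ k, Real.exp (θ * Φ k x))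
      (∑ k, Real.exp (θ * Φ k z) • θ • fderiv ℝ (Φ k) z) z :=
    HasFDerivAt.fun_sum fun k _ => ((hd k z).hasFDerivAt.const_mul θ).exp
  have h0 := hmin.hasFDerivAt_eq_zero hder
  simp only [smul_comm _ θ] at h0
  rw [← Finset.smul_sum] at h0
  exact (smul_eq_zero.1 h0).resolve_left hθ.ne'

/-- This is the entropic optimality system at `θ = 0`, so both kinds of minimizers are zeros of one
smooth map. -/
theorem sum_fderiv_argmin_expectation (hμ : 0 < μ) (hd : ∀ k, Differentiable ℝ (Φ k))
    (hq : ∀ k, StrongQuad μ (Φ k)) :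
    ∑ k, fderiv ℝ (Φ k) (argmin fun x => expectation fun k => Φ k x) = 0 := by
  set z := argmin fun x => expectation fun k => Φ k x with hz
  have hN : 0 < (Fintype.card ι : ℝ) := by exact_mod_cast Fintype.card_pos
  have hmin : IsLocalMin (fun x => ∑ k, Φ k x) z := by
    refine Eventually.of_forall fun x => ?_
    have h := expectation_argmin_le hμ hd hq x
    rw [← hz, expectation, expectation, mul_le_mul_iff_right₀ (by positivity)] at h
    exact h
  exact hmin.hasFDerivAt_eq_zero (HasFDerivAt.fun_sum fun k _ => (hd k z).hasFDerivAt)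

end StronglyConvexQuadratic

theorem _root_.ContinuousAt.clm_neg {α F G : Type*} [TopologicalSpace α] [NormedAddCommGroup F]
    [NormedSpace ℝ F] [NormedAddCommGroup G] [NormedSpace ℝ G] {f : α → F →L[ℝ] G} {x : α}
    (h : ContinuousAt f x) : ContinuousAt (fun y => -f y) x := h.neg

/-! ### Dependence of the minimizer on the risk parameter and on time. -/

section ImplicitMinimizer

variable {n : ℕ} {ι : Type*} {𝒜 : Type*} [NormedAddCommGroup 𝒜] [NormedSpace ℝ 𝒜]

variable {f : ι → 𝒜 × E n → ℝ}

theorem fderiv_slice (hf : ∀ k, ContDiff ℝ ∞ (f k)) (k : ι) (a : 𝒜) (ξ : E n) :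
    fderiv ℝ (fun x => f k (a, x)) ξ =
      fderiv ℝ (f k) (a, ξ) ∘L ContinuousLinearMap.inr ℝ 𝒜 (E n) := by
  have h1 := ((hf k).differentiable (by simp) (a, ξ)).hasFDerivAt
  exact (h1.comp ξ (hasFDerivAt_prodMk_right a ξ)).fderiv

theorem differentiable_slice (hf : ∀ k, ContDiff ℝ ∞ (f k)) (k : ι) (a : 𝒜) :
    Differentiable ℝ fun x => f k (a, x) :=
  ((hf k).differentiable (by simp)).comp
    ((differentiable_const a).prodMk differentiable_id)

variable [Fintype ι]

/-- The first order optimality system `∑ exp(θ f_k(a, ξ)) ∂_ξ f_k(a, ξ)` as a function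
of `((θ, a), ξ)`. -/
def optMap (f : ι → 𝒜 × E n → ℝ) (p : (ℝ × 𝒜) × E n) : E n →L[ℝ] ℝ :=
  ∑ k, Real.exp (p.1.1 * f k (p.1.2, p.2)) •
    (fderiv ℝ (f k) (p.1.2, p.2) ∘L ContinuousLinearMap.inr ℝ 𝒜 (E n))

theorem contDiff_optMap (hf : ∀ k, ContDiff ℝ ∞ (f k)) : ContDiff ℝ 1 (optMap f) := by
  refine ContDiff.sum fun k _ => ?_
  have hp : ContDiff ℝ 1 fun p : (ℝ × 𝒜) × E n => (p.1.2, p.2) := by fun_prop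
  have h1 : ContDiff ℝ 1 (f k) := (hf k).of_le (by exact_mod_cast le_top)
  have h2 : ContDiff ℝ 1 (fderiv ℝ (f k)) :=
    (contDiff_infty_iff_fderiv.1 (hf k)).2.of_le (by exact_mod_cast le_top)
  have h3 : ContDiff ℝ 1 fun p : (ℝ × 𝒜) × E n => p.1.1 := by fun_prop
  exact (Real.contDiff_exp.comp (h3.mul (h1.comp hp))).smul
    ((h2.comp hp).clm_comp contDiff_const)

theorem optMap_eq (hf : ∀ k, ContDiff ℝ ∞ (f k)) (θ : ℝ) (a : 𝒜) (ξ : E n) :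
    optMap f ((θ, a), ξ) =
      ∑ k, Real.exp (θ * f k (a, ξ)) • fderiv ℝ (fun x => f k (a, x)) ξ := by
  simp only [optMap, fderiv_slice hf]

variable {μ θ : ℝ} {a : 𝒜}

/-- On a line each summand is `exp(θ q) q'` with a quadratic `q`, and its derivative `exp(θ q) (θ
q'² + q'')` is positive for every `θ ≥ 0`, including `θ = 0`. -/
theorem exists_hasDerivAt_optMap_line [Nonempty ι] (hf : ∀ k, ContDiff ℝ ∞ (f k)) (hμ : 0 < μ)
    (hθ : 0 ≤ θ) (hq : ∀ k, StrongQuad μ fun x => f k (a, x)) (ξ : E n) {h : E n} (hh : h ≠ 0) :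
    ∃ D : ℝ → ℝ, (∀ s, 0 < D s) ∧
      ∀ s, HasDerivAt (fun s : ℝ => optMap f ((θ, a), ξ + s • h) h) (D s) s := by
  choose β γ hγ hline using fun k => hq k ξ h
  refine ⟨fun s => ∑ k, Real.exp (θ * (f k (a, ξ) + β k * s + γ k * s ^ 2)) *
    (θ * (β k + 2 * γ k * s) ^ 2 + 2 * γ k), fun s => ?_, fun s => ?_⟩
  · refine Finset.sum_pos (fun k _ => mul_pos (Real.exp_pos _) ?_) Finset.univ_nonempty
    have h1 : 0 < μ * ‖h‖ ^ 2 := by positivity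
    have h2 := hγ k
    have h3 : 0 ≤ θ * (β k + 2 * γ k * s) ^ 2 := by positivity
    linarith
  · have e : (fun s : ℝ => optMap f ((θ, a), ξ + s • h) h) = fun s =>
        ∑ k, Real.exp (θ * (f k (a, ξ) + β k * s + γ k * s ^ 2)) * (β k + 2 * γ k * s) := by
      funext s
      rw [optMap_eq hf]
      simp only [sum_apply, smul_apply, smul_eq_mul, hline,
        fderiv_line (differentiable_slice hf _ a) (hline _)]
    rw [e]
    refine HasDerivAt.fun_sum fun k _ => ?_
    have h1 : HasDerivAt (fun s : ℝ => f k (a, ξ) + β k * s + γ k * s ^ 2)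
        (β k + 2 * γ k * s) s := by
      have := (((hasDerivAt_id s).const_mul (β k)).const_add (f k (a, ξ))).add
        (((hasDerivAt_id s).pow 2).const_mul (γ k))
      refine this.congr_deriv ?_
      simp
      ring
    have h2 : HasDerivAt (fun s : ℝ => β k + 2 * γ k * s) (2 * γ k) s := by
      simpa using ((hasDerivAt_id s).const_mul (2 * γ k)).const_add (β k)
    refine (((h1.const_mul θ).exp).mul h2).congr_deriv ?_
    ring

/-- Two zeros would, by Rolle on the segment between them, contradict the positive derivative. -/
theorem optMap_unique_zero [Nonempty ι] (hf : ∀ k, ContDiff ℝ ∞ (f k)) (hμ : 0 < μ)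
    (hθ : 0 ≤ θ) (hq : ∀ k, StrongQuad μ fun x => f k (a, x)) {ξ ζ : E n}
    (hξ : optMap f ((θ, a), ξ) = 0) (hζ : optMap f ((θ, a), ζ) = 0) : ξ = ζ := by
  by_contra hne
  obtain ⟨D, hD, hder⟩ := exists_hasDerivAt_optMap_line hf hμ hθ hq ξ
    (sub_ne_zero.2 (Ne.symm hne))
  obtain ⟨c, _, hc⟩ := exists_hasDerivAt_eq_zero (a := (0 : ℝ)) (b := 1) zero_lt_one
    (fun s _ => (hder s).continuousAt.continuousWithinAt) (by simp [hξ, hζ]) (fun s _ => hder s)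
  exact (hD c).ne' hc

theorem isInvertible_fderiv_optMap [Nonempty ι] (hf : ∀ k, ContDiff ℝ ∞ (f k)) (hμ : 0 < μ)
    (hθ : 0 ≤ θ) (hq : ∀ k, StrongQuad μ fun x => f k (a, x)) (ξ : E n) :
    (fderiv ℝ (optMap f) ((θ, a), ξ) ∘L ContinuousLinearMap.inr ℝ (ℝ × 𝒜) (E n)).IsInvertible := by
  set M := fderiv ℝ (optMap f) ((θ, a), ξ) ∘L ContinuousLinearMap.inr ℝ (ℝ × 𝒜) (E n) with hM
  have hinj : Function.Injective (M : E n →ₗ[ℝ] (E n →L[ℝ] ℝ)) := by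
    rw [injective_iff_map_eq_zero]
    intro h h0
    by_contra hh
    obtain ⟨D, hD, hder⟩ := exists_hasDerivAt_optMap_line hf hμ hθ hq ξ hh
    have h1 : HasDerivAt (fun s : ℝ => ((θ, a), ξ + s • h)) ((0 : ℝ × 𝒜), h) (0 : ℝ) := by
      refine (hasDerivAt_const _ _).prodMk ?_
      simpa using ((hasDerivAt_id (0 : ℝ)).smul_const h).const_add ξ
    have h2 := ((contDiff_optMap hf).differentiable one_ne_zero
      ((θ, a), ξ + (0 : ℝ) • h)).hasFDerivAt.comp_hasDerivAt (0 : ℝ) h1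
    have h3 := h2.clm_apply (hasDerivAt_const (0 : ℝ) h)
    have h4 := h3.unique (hder 0)
    simp only [zero_smul, add_zero, map_zero] at h4
    have h5 : fderiv ℝ (optMap f) ((θ, a), ξ) (0, h) = 0 := h0
    rw [h5] at h4
    exact (hD 0).ne h4
  -- The target is the dual space, so injectivity suffices.
  have hdim : Module.finrank ℝ (E n) = Module.finrank ℝ (E n →L[ℝ] ℝ) :=
    (InnerProductSpace.toDual ℝ (E n)).toLinearEquiv.finrank_eq
  exact ⟨(LinearEquiv.ofInjectiveOfFinrankEq _ hinj hdim).toContinuousLinearEquiv, by ext; rfl⟩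

/-- The derivative of the zero of `optMap` with respect to the parameter `a`. -/
def zeroDeriv (f : ι → 𝒜 × E n → ℝ) (p : (ℝ × 𝒜) × E n) : 𝒜 →L[ℝ] E n :=
  (-(fderiv ℝ (optMap f) p ∘L ContinuousLinearMap.inr ℝ (ℝ × 𝒜) (E n)).inverse ∘L
    (fderiv ℝ (optMap f) p ∘L ContinuousLinearMap.inl ℝ (ℝ × 𝒜) (E n))) ∘L
      ContinuousLinearMap.inr ℝ ℝ 𝒜

theorem continuousAt_zeroDeriv [Nonempty ι] (hf : ∀ k, ContDiff ℝ ∞ (f k)) (hμ : 0 < μ)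
    (hθ : 0 ≤ θ) (hq : ∀ k, StrongQuad μ fun x => f k (a, x)) (ξ : E n) :
    ContinuousAt (zeroDeriv f) ((θ, a), ξ) := by
  have h1 : Continuous (fderiv ℝ (optMap f)) := (contDiff_optMap hf).continuous_fderiv one_ne_zero
  have h2 := ((isInvertible_fderiv_optMap hf hμ hθ hq ξ).contDiffAt_map_inverse
    (n := 1)).continuousAt
  have h3 : ContinuousAt (fun p => (fderiv ℝ (optMap f) p ∘L
      ContinuousLinearMap.inr ℝ (ℝ × 𝒜) (E n)).inverse) ((θ, a), ξ) :=
    ContinuousAt.comp (f := fun p => fderiv ℝ (optMap f) p ∘L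
      ContinuousLinearMap.inr ℝ (ℝ × 𝒜) (E n)) h2 (h1.clm_comp continuous_const).continuousAt
  exact ((h3.clm_neg).clm_comp (h1.clm_comp continuous_const).continuousAt).clm_comp
    continuousAt_const

variable [CompleteSpace 𝒜]

/-- The implicit function theorem in `(θ, a)` jointly. Since `optMap` is defined for all real `θ`,
the value `θ = 0` is an interior parameter. -/
theorem exists_local_zero [Nonempty ι] (hf : ∀ k, ContDiff ℝ ∞ (f k)) (hμ : 0 < μ)
    (hθ : 0 ≤ θ) (hq : ∀ k, StrongQuad μ fun x => f k (a, x)) {ξ : E n}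
    (hξ : optMap f ((θ, a), ξ) = 0) :
    ∃ ψ : ℝ × 𝒜 → E n, ψ (θ, a) = ξ ∧ ContinuousAt ψ (θ, a) ∧
      (∀ᶠ q in 𝓝 (θ, a), optMap f (q, ψ q) = 0) ∧
      HasStrictFDerivAt (fun b => ψ (θ, b)) (zeroDeriv f ((θ, a), ξ)) a := by
  have hd : HasStrictFDerivAt (optMap f) (fderiv ℝ (optMap f) ((θ, a), ξ)) ((θ, a), ξ) :=
    (contDiff_optMap hf).contDiffAt.hasStrictFDerivAt one_ne_zero
  have hi := isInvertible_fderiv_optMap hf hμ hθ hq ξ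
  have hs := hd.hasStrictFDerivAt_implicitFunctionOfProdDomain hi
  refine ⟨hd.implicitFunctionOfProdDomain hi, ?_, hs.continuousAt, ?_, ?_⟩
  · exact (hd.eventually_apply_eq_iff_implicitFunctionOfProdDomain hi).self_of_nhds.1 rfl
  · simpa only [hξ] using hd.eventually_apply_implicitFunctionOfProdDomain hi
  · exact HasStrictFDerivAt.comp (f := fun b : 𝒜 => (θ, b)) a hs 
      ((hasStrictFDerivAt_const θ a).prodMk (hasStrictFDerivAt_id a))

variable [Nonempty ι] {T : ℝ} {c c' : ℝ → 𝒜} {x : ℝ → ℝ → E n}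

/-- Uniqueness of the zero identifies the given family with the local implicit function. -/
theorem continuousOn_zero (hf : ∀ k, ContDiff ℝ ∞ (f k)) (hμ : 0 < μ)
    (hq : ∀ t ∈ Icc 0 T, ∀ k, StrongQuad μ fun z => f k (c t, z)) (hc : ContinuousOn c (Icc 0 T))
    (hx : ∀ θ, 0 ≤ θ → ∀ t ∈ Icc 0 T, optMap f ((θ, c t), x θ t) = 0) :
    ContinuousOn (fun p : ℝ × ℝ => x p.1 p.2) (Ici 0 ×ˢ Icc 0 T) := by
  rintro ⟨θ, t⟩ ⟨hθ, ht⟩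
  obtain ⟨ψ, h1, h2, h3, -⟩ := exists_local_zero hf hμ hθ (hq t ht) (hx θ hθ t ht)
  have hcur : ContinuousWithinAt (fun p : ℝ × ℝ => (p.1, c p.2)) (Ici 0 ×ˢ Icc 0 T) (θ, t) := by
    refine continuousWithinAt_fst.prodMk ?_
    exact ContinuousWithinAt.comp (t := Icc 0 T) (hc t ht) continuousWithinAt_snd
      fun p hp => hp.2
  have hcomp : ContinuousWithinAt (fun p : ℝ × ℝ => ψ (p.1, c p.2)) (Ici 0 ×ˢ Icc 0 T) (θ, t) :=
    ContinuousAt.comp_continuousWithinAt (f := fun p : ℝ × ℝ => (p.1, c p.2)) h2 hcur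
  refine hcomp.congr_of_eventuallyEq ?_ h1.symm
  filter_upwards [hcur.eventually h3, self_mem_nhdsWithin] with p hp hpI
  exact optMap_unique_zero hf hμ hpI.1 (hq p.2 hpI.2) (hx p.1 hpI.1 p.2 hpI.2) hp

theorem continuousOn_zeroDeriv (hf : ∀ k, ContDiff ℝ ∞ (f k)) (hμ : 0 < μ)
    (hq : ∀ t ∈ Icc 0 T, ∀ k, StrongQuad μ fun z => f k (c t, z)) (hc : ContinuousOn c (Icc 0 T))
    (hx : ∀ θ, 0 ≤ θ → ∀ t ∈ Icc 0 T, optMap f ((θ, c t), x θ t) = 0) :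
    ContinuousOn (fun p : ℝ × ℝ => zeroDeriv f ((p.1, c p.2), x p.1 p.2)) (Ici 0 ×ˢ Icc 0 T) := by
  rintro ⟨θ, t⟩ ⟨hθ, ht⟩
  refine ContinuousAt.comp_continuousWithinAt (f := fun p : ℝ × ℝ => ((p.1, c p.2), x p.1 p.2))
    (continuousAt_zeroDeriv hf hμ hθ (hq t ht) (x θ t)) ?_
  refine (continuousWithinAt_fst.prodMk ?_).prodMk
    (continuousOn_zero hf hμ hq hc hx (θ, t) ⟨hθ, ht⟩)
  exact ContinuousWithinAt.comp (t := Icc 0 T) (hc t ht) continuousWithinAt_snd fun p hp => hp.2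

theorem continuousOn_slice {F : Type*} [TopologicalSpace F] {g : ℝ × ℝ → F}
    (hg : ContinuousOn g (Ici 0 ×ˢ Icc 0 T)) {θ : ℝ} (hθ : 0 ≤ θ) :
    ContinuousOn (fun t => g (θ, t)) (Icc 0 T) :=
  hg.comp (continuous_const.prodMk continuous_id).continuousOn fun _ ht => ⟨hθ, ht⟩

theorem isPrimitive_zero (hf : ∀ k, ContDiff ℝ ∞ (f k)) (hμ : 0 < μ)
    (hq : ∀ t ∈ Icc 0 T, ∀ k, StrongQuad μ fun z => f k (c t, z)) (hc : IsPrimitive T c c')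
    (hx : ∀ θ, 0 ≤ θ → ∀ t ∈ Icc 0 T, optMap f ((θ, c t), x θ t) = 0) {θ : ℝ} (hθ : 0 ≤ θ) :
    IsPrimitive T (x θ) (fun t => zeroDeriv f ((θ, c t), x θ t) (c' t)) := by
  refine hc.chain (continuousOn_slice (continuousOn_zeroDeriv hf hμ hq hc.continuousOn hx) hθ) ?_
  intro t ht
  obtain ⟨ψ, -, -, h3, h4⟩ := exists_local_zero hf hμ hθ (hq t ht) (hx θ hθ t ht)
  refine ⟨_, h4, ?_⟩
  have hcur : ContinuousWithinAt (fun s => (θ, c s)) (Icc 0 T) t :=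
    continuousWithinAt_const.prodMk (hc.continuousOn t ht)
  filter_upwards [hcur.eventually h3, self_mem_nhdsWithin] with s hs hsI
  exact optMap_unique_zero hf hμ hθ (hq s hsI) (hx θ hθ s hsI) hs

theorem eventually_norm_sub_le {F : Type*} [NormedAddCommGroup F] {g : ℝ × ℝ → F}
    (hg : ContinuousOn g (Ici 0 ×ˢ Icc 0 T)) {ε : ℝ} (hε : 0 < ε) :
    ∀ᶠ θ in 𝓝[>] (0 : ℝ), ∀ t ∈ Icc 0 T, ‖g (θ, t) - g (0, t)‖ ≤ ε := by
  have hu := (isCompact_Icc.prod isCompact_Icc : IsCompact (Icc (0 : ℝ) 1 ×ˢ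
    Icc 0 T)).uniformContinuousOn_of_continuous
    (hg.mono (prod_mono (fun x hx => hx.1) subset_rfl))
  obtain ⟨δ, hδ, hb⟩ := Metric.uniformContinuousOn_iff_le.1 hu ε hε
  filter_upwards [Ioo_mem_nhdsGT (lt_min hδ zero_lt_one)] with θ hθ t ht
  rw [← dist_eq_norm]
  refine hb (θ, t) ⟨⟨hθ.1.le, (hθ.2.trans_le (min_le_right _ _)).le⟩, ht⟩ (0, t)
    ⟨⟨le_rfl, zero_le_one⟩, ht⟩ ?_
  rw [Prod.dist_eq]
  simp [abs_of_pos hθ.1, (hθ.2.trans_le (min_le_left _ _)).le, hδ.le]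

/-- The derivative of `x θ` is `zeroDeriv` applied to `c'`, which does not depend on `θ`. Uniform
convergence of the operator factor therefore bounds the `L¹` distance of the derivatives by `ε ∫
‖c'‖`. -/
theorem tendsto_normW11_zero (hT : 0 ≤ T) (hf : ∀ k, ContDiff ℝ ∞ (f k)) (hμ : 0 < μ)
    (hq : ∀ t ∈ Icc 0 T, ∀ k, StrongQuad μ fun z => f k (c t, z)) (hc : IsPrimitive T c c')
    (hx : ∀ θ, 0 ≤ θ → ∀ t ∈ Icc 0 T, optMap f ((θ, c t), x θ t) = 0) :
    Tendsto (fun θ => normW11 0 T (x θ - x 0)) (𝓝[>] 0) (𝓝 0) := by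
  have hci : Integrable c' (volume.restrict (Ioo 0 T)) :=
    hc.integrable.mono_set Ioo_subset_Ioc_self
  set K : ℝ := T + ∫ s in Ioo 0 T, ‖c' s‖ with hK
  have hKnn : 0 ≤ K := add_nonneg hT (integral_nonneg fun _ => norm_nonneg _)
  have hbound : ∀ ε > 0, ∀ᶠ θ in 𝓝[>] (0 : ℝ),
      normW11 0 T (x θ - x 0) ≤ ENNReal.ofReal (ε * K) := by
    intro ε hε
    filter_upwards [eventually_norm_sub_le (continuousOn_zero hf hμ hq hc.continuousOn hx) hε,
      eventually_norm_sub_le (continuousOn_zeroDeriv hf hμ hq hc.continuousOn hx) hε,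
      self_mem_nhdsWithin] with θ h1 h2 hθ
    have hp := (isPrimitive_zero hf hμ hq hc hx (le_of_lt hθ)).sub
      (isPrimitive_zero hf hμ hq hc hx le_rfl)
    have hp' : IsPrimitive T (x θ - x 0) (fun t => zeroDeriv f ((θ, c t), x θ t) (c' t) -
      zeroDeriv f ((0, c t), x 0 t) (c' t)) := hp
    rw [hp'.normW11_eq hT, hK, mul_add, ENNReal.ofReal_add (mul_nonneg hε.le hT)
      (mul_nonneg hε.le (integral_nonneg fun _ => norm_nonneg _))]
    refine add_le_add ?_ ?_
    · refine (eLpNorm_le_of_ae_bound (C := ε) ?_).trans ?_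
      · filter_upwards [ae_restrict_mem measurableSet_Ioo] with t ht using h1 t
          (Ioo_subset_Icc_self ht)
      · rw [ENNReal.ofReal_mul hε.le]
        simp [mul_comm]
    · refine (eLpNorm_le_mul_eLpNorm_of_ae_le_mul (c := ε) (g := c') ?_ 1).trans ?_
      · filter_upwards [ae_restrict_mem measurableSet_Ioo] with t ht
        rw [← sub_apply]
        exact ContinuousLinearMap.le_of_opNorm_le _ (h2 t (Ioo_subset_Icc_self ht)) _
      · rw [ENNReal.ofReal_mul hε.le, eLpNorm_one_eq_lintegral_enorm,
          ofReal_integral_norm_eq_lintegral_enorm hci]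
  rw [ENNReal.tendsto_nhds_zero]
  intro ε hε
  rcases eq_or_ne ε ⊤ with rfl | hne
  · exact Eventually.of_forall fun _ => le_top
  have hεr : 0 < ε.toReal := ENNReal.toReal_pos hε.ne' hne
  filter_upwards [hbound (ε.toReal / (K + 1)) (by positivity)] with θ hθ
  refine hθ.trans (ENNReal.ofReal_le_of_le_toReal ?_)
  rw [div_mul_eq_mul_div, div_le_iff₀ (by positivity)]
  nlinarith

end ImplicitMinimizer

/-- The constant is the minimum of the form on the unit sphere; the sphere is empty in dimension
zero. -/
theorem exists_coercive_of_inner_pos {H : Type*} [NormedAddCommGroup H] [InnerProductSpace ℝ H]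
    [FiniteDimensional ℝ H] (L : H →L[ℝ] H) (hL : ∀ x, x ≠ 0 → 0 < inner ℝ x (L x)) :
    ∃ γ > 0, ∀ x, γ * ‖x‖ ^ 2 ≤ inner ℝ x (L x) := by
  have : ProperSpace H := FiniteDimensional.proper ℝ H
  rcases (Metric.sphere (0 : H) 1).eq_empty_or_nonempty with he | hne
  · refine ⟨1, one_pos, fun x => ?_⟩
    have hx : x = 0 := by
      by_contra hx
      have : (‖x‖⁻¹ : ℝ) • x ∈ Metric.sphere (0 : H) 1 := by
        rw [mem_sphere_zero_iff_norm, norm_smul, norm_inv, norm_norm,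
          inv_mul_cancel₀ (norm_ne_zero_iff.2 hx)]
      rw [he] at this
      exact this
    simp [hx]
  · obtain ⟨x₀, hx₀, hmin⟩ := (isCompact_sphere (0 : H) 1).exists_isMinOn hne
      (f := fun x => inner ℝ x (L x)) (continuous_id.inner L.continuous).continuousOn
    have hx₀' : x₀ ≠ 0 := ne_zero_of_mem_unit_sphere ⟨x₀, hx₀⟩
    refine ⟨inner ℝ x₀ (L x₀), hL x₀ hx₀', fun x => ?_⟩
    rcases eq_or_ne x 0 with rfl | hx
    · simp
    have hn : ‖x‖ ≠ 0 := norm_ne_zero_iff.2 hx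
    have hmem : (‖x‖⁻¹ : ℝ) • x ∈ Metric.sphere (0 : H) 1 := by
      rw [mem_sphere_zero_iff_norm, norm_smul, norm_inv, norm_norm, inv_mul_cancel₀ hn]
    have h := hmin hmem
    simp only [mem_ofPred_eq, map_smul, real_inner_smul_left, real_inner_smul_right] at h
    calc inner ℝ x₀ (L x₀) * ‖x‖ ^ 2
        ≤ (‖x‖⁻¹ * (‖x‖⁻¹ * inner ℝ x (L x))) * ‖x‖ ^ 2 := by gcongr
      _ = inner ℝ x (L x) := by field_simp

/-! ### Positive definite matrices as operators. -/

section Matrix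

variable {d : ℕ} {M : Matrix (Fin d) (Fin d) ℝ}

/-- The continuous linear map of a matrix. -/
def matCLM {d e : ℕ} (M : Matrix (Fin e) (Fin d) ℝ) : E d →L[ℝ] E e :=
  LinearMap.toContinuousLinearMap M.toEuclideanLin

theorem matCLM_apply {d e : ℕ} (M : Matrix (Fin e) (Fin d) ℝ) (x : E d) :
    matCLM M x = M.toEuclideanLin x := rfl

theorem matCLM_symm (hM : M.PosDef) (a b : E d) :
    inner ℝ (matCLM M a) b = inner ℝ a (matCLM M b) :=
  (Matrix.isSymmetric_toEuclideanLin_iff.2 hM.1) a b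

theorem matCLM_pos (hM : M.PosDef) (x : E d) (hx : x ≠ 0) : 0 < inner ℝ x (matCLM M x) := by
  have h : WithLp.ofLp x ≠ 0 := fun h => hx (by ext i; exact congrFun h i)
  have := hM.dotProduct_mulVec_pos h
  rw [EuclideanSpace.inner_eq_star_dotProduct, dotProduct_comm]
  simpa [matCLM_apply] using this

theorem matCLM_nonneg (hM : M.PosDef) (x : E d) : 0 ≤ inner ℝ x (matCLM M x) := by
  rcases eq_or_ne x 0 with rfl | hx
  · simp
  · exact (matCLM_pos hM x hx).le

theorem matCLM_inv_apply (hM : M.PosDef) (x : E d) : matCLM M⁻¹ (matCLM M x) = x := by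
  have h := Matrix.nonsing_inv_mul M ((Matrix.isUnit_iff_isUnit_det M).1 hM.isUnit)
  have h2 := congrArg (fun N : Matrix (Fin d) (Fin d) ℝ => N.toEuclideanLin x) h
  simpa [matCLM_apply, Matrix.toLpLin_mul_same, Matrix.toLpLin_one] using h2

end Matrix

/-! ### Value functions encoded by curves of coefficients. -/

section QuadraticCoefficients

variable {n : ℕ}

/-- Coefficients `(P, q, c, Y, z)` of the quadratic polynomial
`ξ ↦ ⟨η, P η⟩ + ⟨q, η⟩ + c` with `η = Y (ξ - z)`. -/
abbrev QuadCoeff (n : ℕ) : Type :=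
  (E n →L[ℝ] E n) × E n × ℝ × (E n →L[ℝ] E n) × E n

/-- The value of the quadratic polynomial with given coefficients. -/
def quadEval (a : QuadCoeff n) (ξ : E n) : ℝ :=
  inner ℝ (a.2.2.2.1 (ξ - a.2.2.2.2)) (a.1 (a.2.2.2.1 (ξ - a.2.2.2.2))) +
    inner ℝ a.2.1 (a.2.2.2.1 (ξ - a.2.2.2.2)) + a.2.2.1

/-- Joint polynomial dependence on coefficients and point: time enters only through the coefficient
curve, so all its roughness is carried there. -/
theorem contDiff_quadEval : ContDiff ℝ ∞ fun p : QuadCoeff n × E n => quadEval p.1 p.2 := by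
  have hY : ContDiff ℝ ∞ fun p : QuadCoeff n × E n => p.1.2.2.2.1 (p.2 - p.1.2.2.2.2) := by
    refine ContDiff.clm_apply ?_ ?_ <;> fun_prop
  have hP : ContDiff ℝ ∞ fun p : QuadCoeff n × E n =>
      p.1.1 (p.1.2.2.2.1 (p.2 - p.1.2.2.2.2)) := by
    refine ContDiff.clm_apply ?_ hY
    fun_prop
  have hq : ContDiff ℝ ∞ fun p : QuadCoeff n × E n => p.1.2.1 := by fun_prop
  have hc : ContDiff ℝ ∞ fun p : QuadCoeff n × E n => p.1.2.2.1 := by fun_prop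
  exact ((hY.inner ℝ hP).add (hq.inner ℝ hY)).add hc

theorem strongQuad_quadEval {a : QuadCoeff n} {μ : ℝ}
    (h : ∀ v, μ * ‖v‖ ^ 2 ≤ inner ℝ (a.2.2.2.1 v) (a.1 (a.2.2.2.1 v))) :
    StrongQuad μ (quadEval a) := by
  obtain ⟨P, q, c, Y, z⟩ := a
  intro ξ v
  refine ⟨inner ℝ (Y (ξ - z)) (P (Y v)) + inner ℝ (Y v) (P (Y (ξ - z))) + inner ℝ q (Y v),
    inner ℝ (Y v) (P (Y v)), h v, fun s => ?_⟩
  have e : ξ + s • v - z = (ξ - z) + s • v := by abel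
  simp only [quadEval, e, map_add Y, map_smul Y]
  generalize Y (ξ - z) = η
  simp only [map_add, map_smul, inner_add_left, inner_add_right, real_inner_smul_left,
    real_inner_smul_right]
  ring

theorem StrongQuad.mono {μ ν : ℝ} {φ : E n → ℝ} (h : StrongQuad μ φ) (hν : ν ≤ μ) :
    StrongQuad ν φ := by
  intro ξ v
  obtain ⟨β, γ, hγ, hq⟩ := h ξ v
  exact ⟨β, γ, (mul_le_mul_of_nonneg_right hν (sq_nonneg _)).trans hγ, hq⟩

namespace LQProblem

variable {U Z : Type*} [NormedAddCommGroup U] [InnerProductSpace ℝ U] [FiniteDimensional ℝ U]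
  [NormedAddCommGroup Z] [InnerProductSpace ℝ Z] [FiniteDimensional ℝ Z]

/-- The coefficients of the value function at time `t`. -/
def coeff (S : LQProblem (E n) U Z) (y : ℝ → Z) (t : ℝ) : QuadCoeff n :=
  (S.cost2 t, S.cost1 y t, S.cost0 y t, S.Y t, (S.part y t).1)

theorem exists_isPrimitive_coeff (S : LQProblem (E n) U Z) {T : ℝ} {y : ℝ → Z}
    (hy : MemLp y 2 (volume.restrict (Ioo 0 T))) : ∃ c', IsPrimitive T (S.coeff y) c' := by
  have hy1 : IntegrableOn y (Ioc 0 T) := by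
    rw [IntegrableOn, ← restrict_Ioo_Ioc]
    exact hy.integrable one_le_two
  obtain ⟨Y', hY⟩ := S.exists_isPrimitive_Y T
  have h1 : IsPrimitive T (S.cost1 y) (S.runq y) := .of_primitive (S.integrable_runq hy1) 0
  have h0 : IsPrimitive T (S.cost0 y) (S.runc y) := .of_primitive (S.integrable_runc hy) 0
  have hx := (S.isPrimitive_part hy1).clm (.fst ℝ (E n) (E n))
  exact ⟨_, (S.isPrimitive_cost2 T).prodMk (h1.prodMk (h0.prodMk (hY.prodMk hx)))⟩

/-- From `v = X (Y v)` and a bound on `X` over `[0, T]`, `‖Y v‖` controls `‖v‖`; this carries the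
coercivity in `η` over to the end state. -/
theorem exists_strongQuad_coeff (S : LQProblem (E n) U Z) (T : ℝ) (y : ℝ → Z) :
    ∃ μ > 0, ∀ t ∈ Icc 0 T, StrongQuad μ (quadEval (S.coeff y t)) := by
  obtain ⟨K, hK⟩ := isCompact_Icc.exists_bound_of_continuousOn
    (S.continuous_X.continuousOn (s := Icc 0 T))
  have hK1 : 0 < |K| + 1 := by positivity
  refine ⟨S.γ / (|K| + 1) ^ 2, div_pos S.γ_pos (by positivity), fun t ht => ?_⟩
  refine strongQuad_quadEval fun v => ?_
  refine le_trans ?_ (S.cost2_coercive ht.1 (S.Y t v))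
  have h1 : ‖v‖ ≤ (|K| + 1) * ‖S.Y t v‖ := by
    have := (S.X t).le_of_opNorm_le ((hK t ht).trans ((le_abs_self K).trans (by linarith)) :
      ‖S.X t‖ ≤ |K| + 1) (S.Y t v)
    rwa [S.X_Y ht.1] at this
  have h2 : ‖v‖ ^ 2 ≤ ((|K| + 1) * ‖S.Y t v‖) ^ 2 := by gcongr
  rw [div_mul_eq_mul_div, div_le_iff₀ (by positivity)]
  calc S.γ * ‖v‖ ^ 2 ≤ S.γ * ((|K| + 1) * ‖S.Y t v‖) ^ 2 :=
        mul_le_mul_of_nonneg_left h2 S.γ_pos.le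
    _ = S.γ * ‖S.Y t v‖ ^ 2 * (|K| + 1) ^ 2 := by ring

theorem ext_Y_fst (S : LQProblem (E n) U Z) {t : ℝ} (ht : 0 ≤ t) (y : ℝ → Z) (ξ : E n) :
    (S.ext y (S.Y t (ξ - (S.part y t).1)) t).1 = ξ := by
  rw [ext, Prod.fst_add, ← X_apply, S.X_Y ht]
  abel

end LQProblem

end QuadraticCoefficients

/-! ### Identification of the value functions and the estimators. -/

namespace UncertainSystem

variable {n m r : ℕ} {ι : Type*}

/-- The linear-quadratic problem that belongs to the parameter `k`. -/
def toLQ (S : UncertainSystem n m r ι) (hΓ : ∀ k, (S.Γ k).PosDef) (hR : ∀ k, (S.R k).PosDef)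
    (hQ : ∀ k, (S.Q k).PosDef) (k : ι) : LQProblem (E n) (E m) (E r) where
  A := matCLM (S.A k)
  B := matCLM S.B
  C := matCLM S.C
  W := matCLM (S.Γ k)⁻¹
  R := matCLM (S.R k)
  Ri := matCLM (S.R k)⁻¹
  -- Here `Q` is the weight itself, hence an inverse, whereas the weight of the disturbance is `Ri`.
  Q := matCLM (S.Q k)⁻¹
  x₀ := S.x₀
  γ := (exists_coercive_of_inner_pos _ (matCLM_pos (hΓ k).inv)).choose
  γ_pos := (exists_coercive_of_inner_pos _ (matCLM_pos (hΓ k).inv)).choose_spec.1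
  W_coercive := (exists_coercive_of_inner_pos _ (matCLM_pos (hΓ k).inv)).choose_spec.2
  W_symm := matCLM_symm (hΓ k).inv
  Ri_R := matCLM_inv_apply (hR k)
  Ri_symm := matCLM_symm (hR k).inv
  Ri_nonneg := matCLM_nonneg (hR k).inv
  Q_symm := matCLM_symm (hQ k).inv
  Q_nonneg := matCLM_nonneg (hQ k).inv

variable (S : UncertainSystem n m r ι) (hΓ : ∀ k, (S.Γ k).PosDef) (hR : ∀ k, (S.R k).PosDef)
  (hQ : ∀ k, (S.Q k).PosDef)

theorem cost_eq_totalCost (y : ℝ → E r) (k : ι) {t : ℝ} (ht : 0 ≤ t) (x : ℝ → E n) (v : ℝ → E m) :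
    S.cost y k t x v = (S.toLQ hΓ hR hQ k).totalCost y t x v := by
  rw [cost, integral_Ioo_eq_interval ht]
  rfl

/-- The value function is a quadratic polynomial in the state. -/
theorem value_eq_quadEval {T : ℝ} {y : ℝ → E r} (hy : MemLpI 2 0 T y) (k : ι) {t : ℝ}
    (ht : t ∈ Icc 0 T) (ξ : E n) :
    S.value y k t ξ = quadEval ((S.toLQ hΓ hR hQ k).coeff y t) ξ := by
  set P := S.toLQ hΓ hR hQ k with hP
  have hyt : MemLp y 2 (volume.restrict (Ioo 0 t)) :=
    MemLp.mono_measure (Measure.restrict_mono (Ioo_subset_Ioo_right ht.2) le_rfl) hy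
  have hy1 : IntegrableOn y (Ioc 0 t) := by
    rw [IntegrableOn, ← LQProblem.restrict_Ioo_Ioc]
    exact hyt.integrable one_le_two
  set η := P.Y t (ξ - (P.part y t).1) with hη
  have hend : (P.ext y η t).1 = ξ := P.ext_Y_fst ht.1 y ξ
  have hquad : quadEval (P.coeff y t) ξ =
      P.totalCost y t (fun s => (P.ext y η s).1) (P.control y η) := by
    rw [P.totalCost_ext ht.1 hyt]
    rfl
  rw [hquad]
  rcases ht.1.eq_or_lt with h0 | hpos
  · rw [value, if_neg (by rw [← h0]; exact lt_irrefl 0)]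
    subst h0
    simp only [LQProblem.totalCost, hend, intervalIntegral.integral_same, add_zero]
    rfl
  rw [value, if_pos hpos]
  have h1 := P.isPrimitive_ext_fst hy1 η
  have hvc : ContinuousOn (P.control y η) (Icc 0 t) :=
    (P.R ∘L ContinuousLinearMap.adjoint P.B).continuous.comp_continuousOn
      (P.isPrimitive_ext_snd hy1 η).continuousOn
  have hw := h1.hasWeakDeriv hpos.le
  -- The infimum is attained by the extremal ending in `ξ`. Any competitor is first turned from a
  -- weak solution into an absolutely continuous one.
  refine IsLeast.csInf_eq ⟨⟨_, P.control y η, ⟨h1.continuousOn, ⟨memLp_of_continuousOn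
    h1.continuousOn, _, memLp_of_continuousOn ?_, hw⟩, memLp_of_continuousOn hvc, hw, hend⟩,
    (S.cost_eq_totalCost hΓ hR hQ y k hpos.le _ _).symm⟩, ?_⟩
  · exact (P.A.continuous.comp_continuousOn h1.continuousOn).add
      (P.B.continuous.comp_continuousOn hvc)
  · rintro c ⟨x, v, ⟨hxc, -, hv, hwx, hxt⟩, rfl⟩
    rw [S.cost_eq_totalCost hΓ hR hQ y k hpos.le]
    have hv1 : IntegrableOn v (Ioc 0 t) := by
      rw [IntegrableOn, ← LQProblem.restrict_Ioo_Ioc]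
      exact MemLp.integrable one_le_two hv
    have hg : IntegrableOn (fun s => P.A (x s) + P.B (v s)) (Ioc 0 t) :=
      (((P.A.continuous.comp_continuousOn hxc).integrableOn_compact isCompact_Icc).mono_set
        Ioc_subset_Icc_self).add (P.B.integrable_comp hv1)
    exact P.totalCost_ext_le hpos.le hyt (isPrimitive_of_hasWeakDeriv hpos hxc hwx hg) hv
      (hxt.trans hend.symm)

end UncertainSystem

namespace UncertainSystem

variable {n m r : ℕ} {ι : Type*} [Fintype ι]

/-- The minimizer `x̂_θ(t)`, including the limiting case `θ = 0`. -/
def minimizer (S : UncertainSystem n m r ι) (y : ℝ → E r) (θ t : ℝ) : E n :=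
  if θ = 0 then S.xhatZero y t else S.xhat y θ t

theorem minimizer_zero (S : UncertainSystem n m r ι) (y : ℝ → E r) :
    S.minimizer y 0 = S.xhatZero y := by
  funext t
  simp [minimizer]

theorem minimizer_of_pos (S : UncertainSystem n m r ι) (y : ℝ → E r) {θ : ℝ} (hθ : 0 < θ) :
    S.minimizer y θ = S.xhat y θ := by
  funext t
  simp [minimizer, hθ.ne']

variable {𝒜 : Type*} [NormedAddCommGroup 𝒜] [NormedSpace ℝ 𝒜]

/-- The value functions are the slices of smooth functions `f k`, evaluated along an absolutely
continuous curve `c` of parameters; the slices are quadratic with leading part bounded below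
by `μ ‖·‖²`. -/
structure QuadraticValue (S : UncertainSystem n m r ι) (y : ℝ → E r) (T μ : ℝ)
    (f : ι → 𝒜 × E n → ℝ) (c c' : ℝ → 𝒜) : Prop where
  pos : 0 < μ
  contDiff : ∀ k, ContDiff ℝ ∞ (f k)
  isPrimitive : IsPrimitive T c c'
  strongQuad : ∀ t ∈ Icc 0 T, ∀ k, StrongQuad μ fun z => f k (c t, z)
  value_eq : ∀ t ∈ Icc 0 T, ∀ k z, S.value y k t z = f k (c t, z)

theorem contDiff_pi_slice {q : 𝒜 × E n → ℝ} (hq : ContDiff ℝ ∞ q) (k : ι) :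
    ContDiff ℝ ∞ fun p : (ι → 𝒜) × E n => q (p.1 k, p.2) :=
  hq.comp (((contDiff_apply ℝ 𝒜 k).comp contDiff_fst).prodMk contDiff_snd)

/-- All parameters share one curve in the product of the coefficient spaces, and the smallest of the
finitely many constants serves for all. -/
theorem quadraticValue_pi [Nonempty ι] (S : UncertainSystem n m r ι) {T : ℝ} {y : ℝ → E r}
    [CompleteSpace 𝒜] {q : 𝒜 × E n → ℝ} (hq : ContDiff ℝ ∞ q) {c : ι → ℝ → 𝒜}
    (hc : ∀ k, ∃ c', IsPrimitive T (c k) c')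
    (hs : ∀ k, ∃ μ > 0, ∀ t ∈ Icc 0 T, StrongQuad μ fun z => q (c k t, z))
    (hv : ∀ t ∈ Icc 0 T, ∀ k z, S.value y k t z = q (c k t, z)) :
    ∃ μ c', S.QuadraticValue y T μ (fun k (p : (ι → 𝒜) × E n) => q (p.1 k, p.2))
      (fun t k => c k t) c' := by
  choose c' hc' using hc
  choose μ hμ hs using hs
  obtain ⟨k₀, hk₀⟩ := Finite.exists_min μ
  exact ⟨μ k₀, fun t k => c' k t, hμ k₀, contDiff_pi_slice hq, IsPrimitive.pi hc',
    fun t ht k => (hs k t ht).mono (hk₀ k), hv⟩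

variable {S : UncertainSystem n m r ι} {y : ℝ → E r} {T μ : ℝ} {f : ι → 𝒜 × E n → ℝ}
  {c c' : ℝ → 𝒜}

theorem QuadraticValue.optMap_minimizer [Nonempty ι] (h : S.QuadraticValue y T μ f c c')
    (θ : ℝ) (hθ : 0 ≤ θ) (t : ℝ) (ht : t ∈ Icc 0 T) :
    optMap f ((θ, c t), S.minimizer y θ t) = 0 := by
  have hd := fun k => differentiable_slice h.contDiff k (c t)
  rw [optMap_eq h.contDiff]
  rcases hθ.eq_or_lt with rfl | hpos
  · rw [minimizer_zero, xhatZero]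
    simp only [h.value_eq t ht, zero_mul, Real.exp_zero, one_smul]
    exact sum_fderiv_argmin_expectation h.pos hd (h.strongQuad t ht)
  · rw [S.minimizer_of_pos y hpos, xhat]
    simp only [h.value_eq t ht]
    exact sum_exp_smul_fderiv_argmin_entropicRisk h.pos hd (h.strongQuad t ht) hpos

theorem QuadraticValue.norm_xhat_sub_xhatInfty_le [Nonempty ι]
    (h : S.QuadraticValue y T μ f c c') {θ : ℝ} (hθ : 0 < θ) {t : ℝ} (ht : t ∈ Icc 0 T) :
    ‖S.xhat y θ t - S.xhatInfty y t‖ ≤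
      Real.sqrt (2 / μ * (Real.log (Fintype.card ι) / θ)) := by
  have hd := fun k => differentiable_slice h.contDiff k (c t)
  refine Real.le_sqrt_of_sq_le ?_
  simp only [xhat, xhatInfty, h.value_eq t ht]
  exact norm_argmin_entropicRisk_sub_le h.pos hd (h.strongQuad t ht) hθ

variable [CompleteSpace 𝒜]

theorem QuadraticValue.isPrimitive_minimizer [Nonempty ι] (h : S.QuadraticValue y T μ f c c')
    {θ : ℝ} (hθ : 0 ≤ θ) : ∃ g, IsPrimitive T (S.minimizer y θ) g :=
  ⟨_, isPrimitive_zero h.contDiff h.pos h.strongQuad h.isPrimitive h.optMap_minimizer hθ⟩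

theorem QuadraticValue.tendsto_normW11 [Nonempty ι] (h : S.QuadraticValue y T μ f c c')
    (hT : 0 ≤ T) :
    Tendsto (fun θ : ℝ => normW11 0 T (S.xhat y θ - S.xhatZero y)) (𝓝[>] 0) (𝓝 0) := by
  refine (tendsto_normW11_zero hT h.contDiff h.pos h.strongQuad h.isPrimitive
    h.optMap_minimizer).congr' ?_
  filter_upwards [self_mem_nhdsWithin] with θ hθ
  rw [S.minimizer_of_pos y hθ, S.minimizer_zero y]

end UncertainSystem

/-- A family of continuous functions on `[0, T]` that converges uniformly converges in `L^p`. -/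
theorem memLpI_and_tendsto_normLp_of_uniform {d : ℕ} {T : ℝ} {p : ℝ≥0∞}
    {u : ℝ → ℝ → E d} {w : ℝ → E d} {b : ℝ → ℝ} (hu : ∀ θ, 0 < θ → ContinuousOn (u θ) (Icc 0 T))
    (hb : Tendsto b atTop (𝓝 0))
    (huw : ∀ θ, 0 < θ → ∀ t ∈ Icc 0 T, ‖u θ t - w t‖ ≤ b θ) :
    MemLpI p 0 T w ∧ Tendsto (fun θ => normLp p 0 T (u θ - w)) atTop (𝓝 0) := by
  -- Measurability of `w` is inherited from a sequence of continuous functions; the shift by one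
  -- keeps the index positive.
  have hmeas : AEStronglyMeasurable w (volume.restrict (Ioo 0 T)) := by
    refine aestronglyMeasurable_of_tendsto_ae (u := atTop) (f := fun j : ℕ => u ((j : ℝ) + 1))
      (fun j => (memLp_of_continuousOn (p := 1) (hu _ (by positivity))).1) ?_
    filter_upwards [ae_restrict_mem measurableSet_Ioo] with t ht
    rw [tendsto_iff_norm_sub_tendsto_zero]
    refine squeeze_zero (fun _ => norm_nonneg _)
      (fun j => huw _ (by positivity) t (Ioo_subset_Icc_self ht)) ?_
    exact hb.comp (tendsto_atTop_add_const_right _ _ tendsto_natCast_atTop_atTop)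
  have hbound : ∀ θ, 0 < θ → ∀ᵐ t ∂volume.restrict (Ioo 0 T), ‖(u θ - w) t‖ ≤ b θ := by
    intro θ hθ
    filter_upwards [ae_restrict_mem measurableSet_Ioo] with t ht
    exact huw θ hθ t (Ioo_subset_Icc_self ht)
  constructor
  · have h1 : MemLp (u 1) p (volume.restrict (Ioo 0 T)) :=
      memLp_of_continuousOn (hu 1 one_pos)
    have h2 : MemLp (u 1 - w) p (volume.restrict (Ioo 0 T)) :=
      MemLp.of_bound (h1.1.sub hmeas) (b 1) (hbound 1 one_pos)
    simpa [MemLpI] using h1.sub h2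
  · have hlim : Tendsto (fun θ => (volume.restrict (Ioo 0 T)) univ ^ p.toReal⁻¹ *
        ENNReal.ofReal (b θ)) atTop (𝓝 0) := by
      have h1 := ENNReal.tendsto_ofReal hb
      rw [ENNReal.ofReal_zero] at h1
      have h2 := ENNReal.Tendsto.const_mul (a := (volume.restrict (Ioo 0 T)) univ ^ p.toReal⁻¹) h1
        (Or.inr (ENNReal.rpow_ne_top_of_nonneg (by positivity) (measure_ne_top _ _)))
      rwa [mul_zero] at h2
    refine tendsto_of_tendsto_of_tendsto_of_le_of_le' tendsto_const_nhds hlim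
      (Eventually.of_forall fun _ => zero_le) ?_
    filter_upwards [eventually_gt_atTop 0] with θ hθ
    exact eLpNorm_le_of_ae_bound (hbound θ hθ)

end RiskAverseKalman

end

open RiskAverseKalman in
theorem proposition4p3 {n m r : ℕ} {ι : Type*} [Fintype ι] [Nonempty ι]
    (S : UncertainSystem n m r ι)
    (hΓ : ∀ k, (S.Γ k).PosDef) (hR : ∀ k, (S.R k).PosDef) (hQ : ∀ k, (S.Q k).PosDef)
    (T : ℝ) (hT : 0 < T) (y : ℝ → E r) (hy : MemLpI 2 0 T y) :
    ((∀ θ : ℝ, 0 < θ → MemW1 1 0 T (S.xhat y θ)) ∧ MemW1 1 0 T (S.xhatZero y) ∧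
      Tendsto (fun θ : ℝ => normW11 0 T (S.xhat y θ - S.xhatZero y)) (𝓝[>] 0) (𝓝 0)) ∧
    (∀ p : ℝ≥0∞, 1 ≤ p → p ≠ ⊤ →
      (∀ θ : ℝ, 0 < θ → MemLpI p 0 T (S.xhat y θ)) ∧ MemLpI p 0 T (S.xhatInfty y) ∧
      Tendsto (fun θ : ℝ => normLp p 0 T (S.xhat y θ - S.xhatInfty y)) atTop (𝓝 0)) := by
  obtain ⟨μ, c', h⟩ := S.quadraticValue_pi (y := y) contDiff_quadEval
    (fun k => (S.toLQ hΓ hR hQ k).exists_isPrimitive_coeff hy)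
    (fun k => (S.toLQ hΓ hR hQ k).exists_strongQuad_coeff T y)
    (fun t ht k z => S.value_eq_quadEval hΓ hR hQ hy k ht z)
  have hcont : ∀ θ, 0 < θ → ContinuousOn (S.xhat y θ) (Icc 0 T) := fun θ hθ => by
    obtain ⟨g, hg⟩ := h.isPrimitive_minimizer hθ.le
    rw [S.minimizer_of_pos y hθ] at hg
    exact hg.continuousOn
  refine ⟨⟨fun θ hθ => ?_, ?_, h.tendsto_normW11 hT.le⟩,
    fun p _ _ => ⟨fun θ hθ => memLp_of_continuousOn (hcont θ hθ), ?_⟩⟩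
  · obtain ⟨g, hg⟩ := h.isPrimitive_minimizer hθ.le
    rw [S.minimizer_of_pos y hθ] at hg
    exact hg.memW1 hT.le
  · obtain ⟨g, hg⟩ := h.isPrimitive_minimizer le_rfl
    rw [S.minimizer_zero y] at hg
    exact hg.memW1 hT.le
  · refine memLpI_and_tendsto_normLp_of_uniform hcont ?_
      fun θ hθ t ht => h.norm_xhat_sub_xhatInfty_le hθ ht
    have h1 : Tendsto (fun θ : ℝ => 2 / μ * (Real.log (Fintype.card ι) / θ)) atTop (𝓝 0) := by
      simpa using (tendsto_const_nhds.div_atTop tendsto_id).const_mul (2 / μ)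
    simpa using h1.sqrt
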